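/- For a matrix $H\in\mathbb F_2^{m\times n}$ (whose rows are the checks of the code $C=\ker H$) say that $H$ is LDPC with locality $w$ if every row and every column of $H$ has weight at most $w$, and that $C$ is locally testable through $H$ with soundness $\rho$ if $\frac1m|Hx|\ge\frac{\rho}{n}\,d(x,C)$ for all $x\in\mathbb F_2^n$, where $d(x,C)$ is the Hamming distance from $x$ to $C$. For a CSS code $Q=\mathrm{css}(H_X,H_Z)$ on $N$ qubits, with stabilizer generators $S_1,\dots,S_M$ (an operator $X^r$ for each row $r$ of $H_X$, an operator $Z^r$ for each row $r$ of $H_Z$), say that $Q$ is a quantum locally testable code with soundness $\rho$ and check weight $b$ if all generators have weight at most $b$ and $$\frac1M\sum_{i=1}^M\tfrac12(I-S_i)\succeq\frac{\rho}{N}\,D_Q,\qquad D_Q=\sum_{t\ge1}t\,(\Pi_{Q_t}-\Pi_{Q_{t-1}}),$$ where $Q_t$ is the span of all $(A_1\otimes\cdots\otimes A_N)|\psi\rangle$ with $|\psi\rangle$ in the code space and at most $t$ of the factors $A_i$ different from $I$, and $\Pi_{Q_t}$ is the orthogonal projector onto $Q_t$. For $\ell\ge2$ let $E=\mathbb F_2^{\ell-1}$,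 $V=\mathbb F_2^{\ell}$, and let $B:E\to V$ be the incidence matrix of the star graph with $\ell$ vertices and $\ell-1$ edges ($Be_i=v_i+v_\ell$). Let $Q_\ell(H)$ be the distance balancing by $B$ of the gauge-fixed code $\mathrm{css}([H,H],[I,I])$: it is the CSS code read off from the three lowest degrees of the product of the complexes $\mathbb F_2^n\xrightarrow{[I,I]^T}\mathbb F_2^{2n}\xrightarrow{[H,H]}\mathbb F_2^m$ and $E\xrightarrow{B}V$, with qubits $(\mathbb F_2^{2n}\otimes V)\oplus(\mathbb F_2^m\otimes E)$, $X$-generators given by $\mathbb F_2^m\otimes V$, and $Z$-generators given by $(\mathbb F_2^{2n}\otimes E)\oplus(\mathbb F_2^n\otimes V)$. **Theorem.** There is an absolute constant $c_0>0$, and for every $w$ there are constants $c>0$ and $K\in\mathbb N$ depending only on $w$, such that the following holds for every integer $\ell\ge2$, every $\rho>0$ and every LDPC matrix $H\in\mathbb F_2^{m\times n}$ of locality $w$ for which $C=\ker H$ has parameters $[n,k,d]$ (so $C\neq 0$ and $d$ is its minimum distance) and is locally testable through $H$ with soundness $\rho$. 1. $Q_\ell(H)$ has parameters $[N,\,k,\,\min(d,2\ell)]$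 with $N=2n\ell+m(\ell-1)$: it has $N$ physical qubits, a code space of dimension $2^k$, and minimum distance $\min(d,2\ell)$. 2. If $d\ge2$, then $Q_\ell(H)$ is a quantum locally testable code with soundness $c\rho$ and check weight $K\ell$. Moreover, for every $d\ge1$ and with absolute constants, its two classical component codes are locally testable with check weight $K\ell$: the kernel of its $X$-check matrix with soundness $c_0\min(\rho,1)$, and the kernel of its $Z$-check matrix with soundness $c_0$. 3. There is a set of exactly a $1/\ell$ fraction of the $X$-generators such that each generator in it has weight between $\ell/K$ and $K\ell$, and each $X$-generator outside it has weight at most $K$. Every $Z$-generator has weight at most $K$. 4. There is a set of at most a $1/\ell$ fraction of the qubits such that each qubit in it is in between $\ell/K$ and $K\ell$ of the $Z$-generators, and each qubit outside it is in at most $K$ of the $Z$-generators. Every qubit is in at most $K$ of the $X$-generators. -/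

import Mathlib

open scoped Kronecker

noncomputable section

/-! ### Classical binary linear codes -/

/-- The code `ker H` with parity-check matrix `H`; the rows of `H` are the checks. -/
def kerCode {M ι : Type*} [Fintype ι] (H : Matrix M ι (ZMod 2)) :
    Submodule (ZMod 2) (ι → ZMod 2) :=
  LinearMap.ker H.mulVecLin

/-- The Hamming distance from a word to a code. -/
def distTo {ι : Type*} [Fintype ι] (x : ι → ZMod 2) (C : Submodule (ZMod 2) (ι → ZMod 2)) : ℕ :=
  sInf {t | ∃ c ∈ C, hammingDist x c = t}

/-- The dual code `C^⊥`. -/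
def dualCode {ι : Type*} [Fintype ι] (C : Submodule (ZMod 2) (ι → ZMod 2)) :
    Submodule (ZMod 2) (ι → ZMod 2) where
  carrier := {x | ∀ c ∈ C, x ⬝ᵥ c = 0}
  add_mem' := by
    intro a b ha hb c hc
    rw [add_dotProduct, ha c hc, hb c hc, add_zero]
  zero_mem' := by
    intro c _
    exact zero_dotProduct c
  smul_mem' := by
    intro r a ha c hc
    rw [smul_dotProduct, ha c hc, smul_zero]

/-- The code `C` has parameters `[n, k, d]`: block length `n`, dimension `k`, and minimum
distance `d`. (A minimum distance exists only when `C` has a nonzero codeword.) -/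
def HasParams {ι : Type*} [Fintype ι] (C : Submodule (ZMod 2) (ι → ZMod 2)) (n k d : ℕ) : Prop :=
  Fintype.card ι = n ∧ Module.finrank (ZMod 2) C = k ∧
    IsLeast {t | ∃ c ∈ C, c ≠ 0 ∧ hammingNorm c = t} d

/-- The weight of check `i`: the number of bits it involves. -/
def rowWeight {M ι : Type*} [Fintype ι] (H : Matrix M ι (ZMod 2)) (i : M) : ℕ :=
  hammingNorm (H i)

/-- The degree of bit `j`: the number of checks that involve it. -/
def colWeight {M ι : Type*} [Fintype M] (H : Matrix M ι (ZMod 2)) (j : ι) : ℕ :=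
  hammingNorm (fun i => H i j)

/-- Low density with locality `w`: every check involves at most `w` bits, and every bit is
involved in at most `w` checks. -/
def IsLDPC {M ι : Type*} [Fintype M] [Fintype ι] (H : Matrix M ι (ZMod 2)) (w : ℕ) : Prop :=
  (∀ i, rowWeight H i ≤ w) ∧ ∀ j, colWeight H j ≤ w

/-- `ker H` is locally testable, through the checks of `H`, with soundness `ρ` and check weight
(at most) `w`. -/
def IsLTC {M ι : Type*} [Fintype M] [Fintype ι] (H : Matrix M ι (ZMod 2)) (ρ : ℝ) (w : ℕ) : Prop :=
  (∀ i, rowWeight H i ≤ w) ∧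
    ∀ x : ι → ZMod 2, ρ / (Fintype.card ι : ℝ) * (distTo x (kerCode H) : ℝ) ≤
      (hammingNorm (H.mulVec x) : ℝ) / (Fintype.card M : ℝ)

/-! ### Qubits, Pauli operators, CSS codes -/

/-- The Hilbert space of qubits indexed by `ι`: the orthonormal computational basis is indexed by
`ι → Fin 2`. -/
abbrev Qubits (ι : Type*) [Fintype ι] : Type _ := EuclideanSpace ℂ (ι → Fin 2)

/-- The operator `⨂ i, A i`. -/
def tensorOp {ι : Type*} [Fintype ι] [DecidableEq ι] (A : ι → Matrix (Fin 2) (Fin 2) ℂ) :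
    Qubits ι →L[ℂ] Qubits ι :=
  Matrix.toEuclideanCLM (n := ι → Fin 2) (𝕜 := ℂ)
    (Matrix.of fun b b' => ∏ i, A i (b i) (b' i))

/-- The Pauli operator `X^v`. -/
def pauliX {ι : Type*} [Fintype ι] [DecidableEq ι] (v : ι → ZMod 2) : Qubits ι →L[ℂ] Qubits ι :=
  tensorOp fun i => if v i = 0 then 1 else !![0, 1; 1, 0]

/-- The Pauli operator `Z^v`. -/
def pauliZ {ι : Type*} [Fintype ι] [DecidableEq ι] (v : ι → ZMod 2) : Qubits ι →L[ℂ] Qubits ι :=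
  tensorOp fun i => if v i = 0 then 1 else !![1, 0; 0, -1]

/-- The data `css(H_X, H_Z)` on qubits indexed by `ι`: the rows `r` of `H_X` give the
`X`-stabilizer generators `X^r`, the rows of `H_Z` the `Z`-stabilizer generators `Z^r`. -/
structure CSSCode (MX MZ ι : Type*) [Fintype ι] where
  hX : Matrix MX ι (ZMod 2)
  hZ : Matrix MZ ι (ZMod 2)
  comm : hX * hZ.transpose = 0

namespace CSSCode

variable {MX MZ ι : Type*} [Fintype ι]

/-- The stabilizer generators. -/
def generator [DecidableEq ι] (Q : CSSCode MX MZ ι) : MX ⊕ MZ → (Qubits ι →L[ℂ] Qubits ι)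
  | Sum.inl i => pauliX (Q.hX i)
  | Sum.inr j => pauliZ (Q.hZ j)

/-- The weights of the stabilizer generators. -/
def generatorWeight (Q : CSSCode MX MZ ι) : MX ⊕ MZ → ℕ
  | Sum.inl i => rowWeight Q.hX i
  | Sum.inr j => rowWeight Q.hZ j

/-- The code space: the states fixed by all stabilizer generators. -/
def codeSpace [DecidableEq ι] (Q : CSSCode MX MZ ι) : Submodule ℂ (Qubits ι) where
  carrier := {ψ | ∀ s, Q.generator s ψ = ψ}
  add_mem' := by
    intro a b ha hb s
    rw [map_add, ha s, hb s]
  zero_mem' := fun s => map_zero _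
  smul_mem' := by
    intro r a ha s
    rw [map_smul, ha s]

/-- The weights of the nontrivial logical operators of `X`- and of `Z`-type. -/
def logicalWeights (Q : CSSCode MX MZ ι) : Set ℕ :=
  {t | ∃ c ∈ kerCode Q.hX, c ∉ dualCode (kerCode Q.hZ) ∧ hammingNorm c = t} ∪
    {t | ∃ c ∈ kerCode Q.hZ, c ∉ dualCode (kerCode Q.hX) ∧ hammingNorm c = t}

/-- The quantum code has parameters `[n, k, d]`: `n` physical qubits, `k` logical qubits (a code
space of dimension `2 ^ k`), and minimum distance `d`. -/
def HasParams [DecidableEq ι] (Q : CSSCode MX MZ ι) (n k d : ℕ) : Prop :=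
  Fintype.card ι = n ∧ Module.finrank ℂ Q.codeSpace = 2 ^ k ∧ IsLeast Q.logicalWeights d

end CSSCode

/-! ### Quantum local testability -/

/-- The `t`-fattening of a subspace: the span of all `(⨂ i, A i) ψ` with `ψ` in the subspace and
at most `t` factors `A i` different from the identity. -/
def fattening {ι : Type*} [Fintype ι] [DecidableEq ι] (S : Submodule ℂ (Qubits ι)) (t : ℕ) :
    Submodule ℂ (Qubits ι) :=
  Submodule.span ℂ {φ | ∃ A : ι → Matrix (Fin 2) (Fin 2) ℂ,
    Set.ncard {i | A i ≠ 1} ≤ t ∧ ∃ ψ ∈ S, tensorOp A ψ = φ}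

/-- The operator `D = ∑ t ≥ 1, t (Π_t - Π_{t-1})`, with `Π_t` the orthogonal projector onto the
`t`-fattening; the terms with `t` larger than the number of qubits vanish. -/
def distanceOp {ι : Type*} [Fintype ι] [DecidableEq ι] (S : Submodule ℂ (Qubits ι)) :
    Qubits ι →L[ℂ] Qubits ι :=
  ∑ t ∈ Finset.Icc 1 (Fintype.card ι),
    (t : ℂ) • ((fattening S t).starProjection - (fattening S (t - 1)).starProjection)

/-- The quantum code is locally testable, through its stabilizer generators `S₁, …, S_M`, with
soundness `ρ` and check weight `w`: all generators have weight at most `w`, and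
`(1/M) ∑ (I - S_i)/2 - (ρ/n) D` is a positive semidefinite operator. -/
def CSSCode.IsQLTC {MX MZ ι : Type*} [Fintype MX] [Fintype MZ] [Fintype ι] [DecidableEq ι]
    (Q : CSSCode MX MZ ι) (ρ : ℝ) (w : ℕ) : Prop :=
  (∀ s, Q.generatorWeight s ≤ w) ∧
    ((1 / (Fintype.card (MX ⊕ MZ) : ℂ)) • ∑ s, (1 / 2 : ℂ) • (1 - Q.generator s)
      - ((ρ / (Fintype.card ι : ℝ) : ℝ) : ℂ) • distanceOp Q.codeSpace).IsPositive

/-! ### The construction -/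

/-- The gauge-fixed code `css([H, H], [I, I])`. -/
def gaugeFixed {M ι : Type*} [Fintype ι] [DecidableEq ι]
    (H : Matrix M ι (ZMod 2)) : CSSCode M ι (ι ⊕ ι) where
  hX := Matrix.fromCols H H
  hZ := Matrix.fromCols 1 1
  comm := by
    rw [Matrix.transpose_fromCols, Matrix.fromCols_mul_fromRows]
    simp only [Matrix.transpose_one, Matrix.mul_one]
    ext i j
    exact CharTwo.add_self_eq_zero _

/-- Distance balancing: the homological product of the complex
`𝔽₂^MZ → 𝔽₂^ι → 𝔽₂^MX` (maps `H_Zᵀ`, `H_X`) with the complex `𝔽₂^E → 𝔽₂^V` (map `B`), cut to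
its three lowest degrees: the qubits are `(ι × V) ⊕ (MX × E)`, the `X`-generators `MX × V`, and
the `Z`-generators `(ι × E) ⊕ (MZ × V)`. -/
def distanceBalance {MX MZ ι V E : Type*} [Fintype MX] [DecidableEq MX] [DecidableEq MZ]
    [Fintype ι] [DecidableEq ι] [Fintype V] [DecidableEq V] [Fintype E] [DecidableEq E]
    (Q : CSSCode MX MZ ι) (B : Matrix V E (ZMod 2)) :
    CSSCode (MX × V) ((ι × E) ⊕ (MZ × V)) ((ι × V) ⊕ (MX × E)) where
  hX := Matrix.fromCols (Q.hX ⊗ₖ (1 : Matrix V V (ZMod 2))) ((1 : Matrix MX MX (ZMod 2)) ⊗ₖ B)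
  hZ := Matrix.fromBlocks
    ((1 : Matrix ι ι (ZMod 2)) ⊗ₖ B.transpose) (Q.hX.transpose ⊗ₖ (1 : Matrix E E (ZMod 2)))
    (Q.hZ ⊗ₖ (1 : Matrix V V (ZMod 2))) 0
  comm := by
    rw [Matrix.fromBlocks_transpose, Matrix.fromCols_mul_fromBlocks]
    simp only [← Matrix.kroneckerMap_transpose, Matrix.transpose_transpose, Matrix.transpose_one,
      ← Matrix.mul_kronecker_mul, Matrix.mul_one, Matrix.one_mul, Q.comm, Matrix.transpose_zero,
      Matrix.mul_zero, Matrix.zero_kronecker, add_zero]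
    ext i (j | j)
    · exact CharTwo.add_self_eq_zero _
    · rfl

/-- The vertex-edge incidence matrix of the star graph with `ℓ` vertices, the last vertex being
the centre: edge `e` joins vertex `e` to vertex `ℓ - 1`. -/
def starMatrix (ℓ : ℕ) : Matrix (Fin ℓ) (Fin (ℓ - 1)) (ZMod 2) :=
  Matrix.of fun v e => if v.val = e.val ∨ v.val = ℓ - 1 then 1 else 0

/-- The star-graph distance balancing of the gauge-fixed code `css([H, H], [I, I])`. -/
def starBalanced {n m : ℕ} (H : Matrix (Fin m) (Fin n) (ZMod 2)) (ℓ : ℕ) :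
    CSSCode (Fin m × Fin ℓ)
      (((Fin n ⊕ Fin n) × Fin (ℓ - 1)) ⊕ (Fin n × Fin ℓ))
      (((Fin n ⊕ Fin n) × Fin ℓ) ⊕ (Fin m × Fin (ℓ - 1))) :=
  distanceBalance (gaugeFixed H) (starMatrix ℓ)

end

/-!
A joint eigenspace of the stabilizer generators of a CSS code is labelled by a syndrome, and the
syndromes that occur are the pairs `(H_X b, H_Z a)`. Moving `b` into `ker H_X` by a `Z`-operator and
`a` into `ker H_Z` by an `X`-operator carries the eigenspace into the code space, so it lies in the
fattening of order `d(b, ker H_X) + d(a, ker H_Z)`, while the averaged Hamiltonian acts on it by the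
relative weight of the syndrome. Since these eigenspaces are orthogonal and span everything, quantum
soundness reduces to the soundness of the two classical codes.

Balancing by a star with `ℓ` vertices places a word of `ker H_X` at a single vertex and copies a
word of `ker H_Z` to all vertices. Conversely, modulo stabilizers a word of the new `ker H_X` is
determined by the sum of its vertex blocks, and one of the new `ker H_Z` by its central block. So
the minimum weight of a nontrivial logical operator is kept in `ker H_X` and multiplied by `ℓ` in
`ker H_Z`. A word with a small syndrome is corrected on the edges (for `H_X`) or on the leaves (for
`H_Z`) by the syndrome itself, up to one correction in the original code. The checks of
`css([H, H], [I, I])` only see the sum of the two halves of a word, and its two minimum weights are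
the distance of `ker H` and `2`.

If `d ≥ 2`, every bit lies in a check, so a single flipped bit has distance `1` from the code and
bounds `ρ` and the ratio of the numbers of checks and bits in terms of `w`. This makes up for
measuring both classical soundnesses against the total number of generators.
-/

open scoped Matrix

/-! ### Hamming weights and binary codes -/

section BinaryCodes

variable {α β M : Type*} [Fintype α] [Fintype β]

theorem hammingNorm_eq_sum (x : α → ZMod 2) :
    hammingNorm x = ∑ a, if x a ≠ 0 then 1 else 0 := by
  rw [hammingNorm, Finset.card_filter]

theorem hammingNorm_sum_type (x : α ⊕ β → ZMod 2) :
    hammingNorm x = hammingNorm (fun a => x (.inl a)) + hammingNorm (fun b => x (.inr b)) := by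
  simp only [hammingNorm_eq_sum, Fintype.sum_sum_type]

theorem hammingNorm_prod_type (x : α × β → ZMod 2) :
    hammingNorm x = ∑ b, hammingNorm (fun a => x (a, b)) := by
  simp only [hammingNorm_eq_sum, Fintype.sum_prod_type_right]

theorem hammingNorm_mul (x : α → ZMod 2) (y : β → ZMod 2) :
    hammingNorm (fun p : α × β => x p.1 * y p.2) = hammingNorm x * hammingNorm y := by
  simp only [hammingNorm_eq_sum, Fintype.sum_prod_type, Finset.sum_mul_sum, ne_eq, mul_eq_zero,
    not_or, ite_and, ite_mul, one_mul, zero_mul]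

theorem hammingNorm_single_one [DecidableEq α] (a : α) :
    hammingNorm (Pi.single a 1 : α → ZMod 2) = 1 := by
  simp [hammingNorm_eq_sum, Pi.single_apply]

theorem hammingNorm_add_le (x y : α → ZMod 2) :
    hammingNorm (x + y) ≤ hammingNorm x + hammingNorm y := by
  simpa [hammingDist_eq_hammingNorm, ZModModule.neg_eq_self] using hammingDist_triangle x 0 y

theorem hammingNorm_finset_sum_le {κ : Type*} (s : Finset κ) (x : κ → α → ZMod 2) :
    hammingNorm (∑ c ∈ s, x c) ≤ ∑ c ∈ s, hammingNorm (x c) :=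
  Finset.le_sum_of_subadditive _ hammingNorm_zero.le hammingNorm_add_le s x

theorem mem_kerCode {H : Matrix M α (ZMod 2)} {x : α → ZMod 2} :
    x ∈ kerCode H ↔ H *ᵥ x = 0 :=
  LinearMap.mem_ker

theorem hammingNorm_mulVec_le [Fintype M] {H : Matrix M α (ZMod 2)} {b : ℕ}
    (hH : ∀ j, colWeight H j ≤ b) (x : α → ZMod 2) :
    hammingNorm (H *ᵥ x) ≤ b * hammingNorm x := by
  rw [Matrix.mulVec_eq_sum, hammingNorm_eq_sum x, Finset.mul_sum]
  refine (hammingNorm_finset_sum_le _ _).trans (Finset.sum_le_sum fun j _ => ?_)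
  by_cases hj : x j = 0
  · simp [hj]
  · have hj1 : x j = 1 := Fin.eq_one_of_ne_zero _ hj
    rw [hj1, MulOpposite.op_one, one_smul, if_pos one_ne_zero, mul_one]
    exact hH j

theorem distTo_le_of_add_mem {x z : α → ZMod 2} {C : Submodule (ZMod 2) (α → ZMod 2)}
    (hz : x + z ∈ C) : distTo x C ≤ hammingNorm z :=
  Nat.sInf_le ⟨x + z, hz, by rw [hammingDist_eq_hammingNorm, neg_add_cancel_left]⟩

theorem exists_add_mem_hammingNorm_eq_distTo (x : α → ZMod 2)
    (C : Submodule (ZMod 2) (α → ZMod 2)) :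
    ∃ z, x + z ∈ C ∧ hammingNorm z = distTo x C := by
  obtain ⟨c, hc, hdist⟩ : distTo x C ∈ {t | ∃ c ∈ C, hammingDist x c = t} :=
    Nat.sInf_mem ⟨_, 0, C.zero_mem, rfl⟩
  exact ⟨-x + c, by rwa [add_neg_cancel_left], by rw [← hdist, hammingDist_eq_hammingNorm]⟩

theorem distTo_eq_zero_of_mem {x : α → ZMod 2} {C : Submodule (ZMod 2) (α → ZMod 2)}
    (hx : x ∈ C) : distTo x C = 0 :=
  Nat.le_zero.mp <| hammingNorm_zero (β := fun _ : α => ZMod 2) ▸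
    distTo_le_of_add_mem (by rwa [add_zero])

theorem mem_dualCode {C : Submodule (ZMod 2) (α → ZMod 2)} {x : α → ZMod 2} :
    x ∈ dualCode C ↔ ∀ c ∈ C, x ⬝ᵥ c = 0 :=
  Iff.rfl

theorem dualCode_dualCode (C : Submodule (ZMod 2) (α → ZMod 2)) : dualCode (dualCode C) = C := by
  let B : LinearMap.BilinForm (ZMod 2) (α → ZMod 2) := dotProductBilin (ZMod 2) (ZMod 2)
  have hB : B.IsRefl := fun x y hxy => (dotProduct_comm y x).trans hxy
  have hB₀ : B.Nondegenerate :=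
    ⟨fun x hx => dotProduct_eq_zero x hx,
      fun x hx => dotProduct_eq_zero x fun y => (dotProduct_comm x y).trans (hx y)⟩
  have dualCode_eq (D : Submodule (ZMod 2) (α → ZMod 2)) : dualCode D = B.orthogonal D := by
    ext x
    exact forall₂_congr fun c _ => by rw [dotProduct_comm]; rfl
  rw [dualCode_eq, dualCode_eq, LinearMap.BilinForm.orthogonal_orthogonal hB₀ hB]

theorem dualCode_kerCode [Fintype M] (H : Matrix M α (ZMod 2)) :
    dualCode (kerCode H) = LinearMap.range H.vecMulLinear := by
  suffices h : dualCode (LinearMap.range H.vecMulLinear) = kerCode H by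
    rw [← h, dualCode_dualCode]
  ext x
  simp only [mem_dualCode, LinearMap.mem_range, forall_exists_index, forall_apply_eq_imp_iff,
    mem_kerCode, Matrix.vecMulLinear_apply, dotProduct_comm x, ← Matrix.dotProduct_mulVec]
  refine ⟨fun h => dotProduct_eq_zero _ fun u => (dotProduct_comm _ _).trans (h u), fun h u => ?_⟩
  rw [h, dotProduct_zero]

theorem dualCode_kerCode_transpose [Fintype M] (H : Matrix M α (ZMod 2)) :
    dualCode (kerCode Hᵀ) = LinearMap.range H.mulVecLin := by
  rw [dualCode_kerCode]
  exact congrArg LinearMap.range (LinearMap.ext (Matrix.vecMul_transpose H))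

theorem finrank_quotient_dualCode_kerCode [Finite M] (H : Matrix M α (ZMod 2)) :
    Module.finrank (ZMod 2) ((α → ZMod 2) ⧸ dualCode (kerCode H)) =
      Module.finrank (ZMod 2) (kerCode H) := by
  have := Fintype.ofFinite M
  have hrank : Module.finrank (ZMod 2) (dualCode (kerCode H)) = H.rank := by
    rw [dualCode_kerCode, ← Matrix.mulVecLin_transpose, ← Matrix.rank, Matrix.rank_transpose]
  have hquot := (dualCode (kerCode H)).finrank_quotient_add_finrank
  have hker := H.mulVecLin.finrank_range_add_finrank_ker
  rw [hrank, ← hker, ← Matrix.rank, add_comm H.rank] at hquot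
  exact add_right_cancel hquot

end BinaryCodes

section Weights

variable {M M' α β : Type*}

theorem rowWeight_transpose [Fintype M] (A : Matrix M α (ZMod 2)) (a : α) :
    rowWeight Aᵀ a = colWeight A a :=
  rfl

theorem colWeight_transpose [Fintype α] (A : Matrix M α (ZMod 2)) (i : M) :
    colWeight Aᵀ i = rowWeight A i :=
  rfl

theorem rowWeight_one [Fintype α] [DecidableEq α] (a : α) :
    rowWeight (1 : Matrix α α (ZMod 2)) a = 1 := by
  simp [rowWeight, hammingNorm_eq_sum, Matrix.one_apply]

theorem colWeight_one [Fintype α] [DecidableEq α] (a : α) :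
    colWeight (1 : Matrix α α (ZMod 2)) a = 1 := by
  simp [colWeight, hammingNorm_eq_sum, Matrix.one_apply]

theorem rowWeight_zero [Fintype α] (i : M) : rowWeight (0 : Matrix M α (ZMod 2)) i = 0 :=
  hammingNorm_zero

theorem colWeight_zero [Fintype M] (j : α) : colWeight (0 : Matrix M α (ZMod 2)) j = 0 :=
  hammingNorm_zero

theorem rowWeight_kronecker [Fintype α] [Fintype β] (A : Matrix M α (ZMod 2))
    (B : Matrix M' β (ZMod 2)) (i : M × M') :
    rowWeight (A ⊗ₖ B) i = rowWeight A i.1 * rowWeight B i.2 :=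
  hammingNorm_mul (A i.1) (B i.2)

theorem colWeight_kronecker [Fintype M] [Fintype M'] (A : Matrix M α (ZMod 2))
    (B : Matrix M' β (ZMod 2)) (j : α × β) :
    colWeight (A ⊗ₖ B) j = colWeight A j.1 * colWeight B j.2 :=
  hammingNorm_mul (fun i => A i j.1) fun i => B i j.2

theorem rowWeight_fromCols [Fintype α] [Fintype β] (A : Matrix M α (ZMod 2))
    (B : Matrix M β (ZMod 2)) (i : M) :
    rowWeight (Matrix.fromCols A B) i = rowWeight A i + rowWeight B i :=
  hammingNorm_sum_type _

theorem colWeight_fromCols_inl [Fintype M] (A : Matrix M α (ZMod 2)) (B : Matrix M β (ZMod 2))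
    (j : α) : colWeight (Matrix.fromCols A B) (.inl j) = colWeight A j :=
  rfl

theorem colWeight_fromCols_inr [Fintype M] (A : Matrix M α (ZMod 2)) (B : Matrix M β (ZMod 2))
    (j : β) : colWeight (Matrix.fromCols A B) (.inr j) = colWeight B j :=
  rfl

theorem rowWeight_fromBlocks_inl [Fintype α] [Fintype β] (A : Matrix M α (ZMod 2))
    (B : Matrix M β (ZMod 2)) (C : Matrix M' α (ZMod 2)) (D : Matrix M' β (ZMod 2)) (i : M) :
    rowWeight (Matrix.fromBlocks A B C D) (.inl i) = rowWeight A i + rowWeight B i :=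
  hammingNorm_sum_type _

theorem rowWeight_fromBlocks_inr [Fintype α] [Fintype β] (A : Matrix M α (ZMod 2))
    (B : Matrix M β (ZMod 2)) (C : Matrix M' α (ZMod 2)) (D : Matrix M' β (ZMod 2)) (i : M') :
    rowWeight (Matrix.fromBlocks A B C D) (.inr i) = rowWeight C i + rowWeight D i :=
  hammingNorm_sum_type _

theorem colWeight_fromBlocks_inl [Fintype M] [Fintype M'] (A : Matrix M α (ZMod 2))
    (B : Matrix M β (ZMod 2)) (C : Matrix M' α (ZMod 2)) (D : Matrix M' β (ZMod 2)) (j : α) :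
    colWeight (Matrix.fromBlocks A B C D) (.inl j) = colWeight A j + colWeight C j :=
  hammingNorm_sum_type _

theorem colWeight_fromBlocks_inr [Fintype M] [Fintype M'] (A : Matrix M α (ZMod 2))
    (B : Matrix M β (ZMod 2)) (C : Matrix M' α (ZMod 2)) (D : Matrix M' β (ZMod 2)) (j : β) :
    colWeight (Matrix.fromBlocks A B C D) (.inr j) = colWeight B j + colWeight D j :=
  hammingNorm_sum_type _

end Weights

section LocalTestability

variable {M ι : Type*} [Fintype M] [Fintype ι] {H : Matrix M ι (ZMod 2)} {ρ : ℝ} {w : ℕ}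

theorem isLTC_iff : IsLTC H ρ w ↔ (∀ i, rowWeight H i ≤ w) ∧ ∀ x : ι → ZMod 2,
    ρ * Fintype.card M * distTo x (kerCode H) ≤ Fintype.card ι * hammingNorm (H *ᵥ x) := by
  refine and_congr_right fun _ => forall_congr' fun x => ?_
  by_cases hx : x ∈ kerCode H
  · simp [distTo_eq_zero_of_mem hx, mem_kerCode.mp hx]
  obtain ⟨i, -⟩ : ∃ i, (H *ᵥ x) i ≠ 0 := Function.ne_iff.mp (mt mem_kerCode.mpr hx)
  obtain ⟨j, -⟩ : ∃ j, x j ≠ 0 := Function.ne_iff.mp fun h => hx (h ▸ Submodule.zero_mem _)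
  have hM : (0 : ℝ) < Fintype.card M := Nat.cast_pos.mpr (Fintype.card_pos_iff.mpr ⟨i⟩)
  have hι : (0 : ℝ) < Fintype.card ι := Nat.cast_pos.mpr (Fintype.card_pos_iff.mpr ⟨j⟩)
  rw [div_mul_eq_mul_div, div_le_div_iff₀ hι hM, mul_right_comm, mul_comm (hammingNorm _ : ℝ)]

theorem isLTC_of_distTo_le {κ : ℝ} (hw : ∀ i, rowWeight H i ≤ w) (hρ : 0 ≤ ρ)
    (hκ : ρ * Fintype.card M * κ ≤ Fintype.card ι)
    (hdist : ∀ x, distTo x (kerCode H) ≤ κ * hammingNorm (H *ᵥ x)) : IsLTC H ρ w :=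
  isLTC_iff.mpr ⟨hw, fun x => calc
    ρ * Fintype.card M * distTo x (kerCode H)
      ≤ ρ * Fintype.card M * (κ * hammingNorm (H *ᵥ x)) := by gcongr; exact hdist x
    _ ≤ Fintype.card ι * hammingNorm (H *ᵥ x) := by rw [← mul_assoc]; gcongr⟩

theorem IsLTC.mono {ρ' : ℝ} {w' : ℕ} (h : IsLTC H ρ w) (hρ : ρ' ≤ ρ) (hw : w ≤ w') :
    IsLTC H ρ' w' :=
  ⟨fun i => (h.1 i).trans hw, fun x => le_trans (by gcongr) (h.2 x)⟩

end LocalTestability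

/-! ### Pauli operators -/

section Pauli

variable {ι : Type*} [Fintype ι]

/-- The sign `(-1) ^ a` of a bit `a`, as an additive character. -/
noncomputable def phase : AddChar (ZMod 2) ℂ := AddChar.zmodChar 2 (ζ := -1) (by norm_num)

theorem phase_one : phase 1 = -1 :=
  pow_one _

theorem phase_of_ne_zero {a : ZMod 2} (ha : a ≠ 0) : phase a = -1 := by
  have ha1 : a = 1 := Fin.eq_one_of_ne_zero _ ha
  rw [ha1, phase_one]

theorem phase_mul_self (a : ZMod 2) : phase a * phase a = 1 := by
  rw [← AddChar.map_add_eq_mul, CharTwo.add_self_eq_zero, AddChar.map_zero_eq_one]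

theorem phase_injective : Function.Injective phase := by
  intro a b hab
  by_contra hne
  have h := phase_of_ne_zero (sub_ne_zero.mpr hne)
  rw [CharTwo.sub_eq_add, AddChar.map_add_eq_mul, hab, phase_mul_self] at h
  norm_num at h

theorem exists_phase_eq_of_mul_self_eq_one {z : ℂ} (hz : z * z = 1) : ∃ a, phase a = z := by
  rcases mul_self_eq_one_iff.mp hz with rfl | rfl
  exacts [⟨0, AddChar.map_zero_eq_one _⟩, ⟨1, phase_one⟩]

theorem phase_dotProduct (v b : ι → ZMod 2) : phase (v ⬝ᵥ b) = ∏ i, phase (v i * b i) :=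
  map_prod phase.toMonoidHom (fun i => Multiplicative.ofAdd (v i * b i)) Finset.univ

/-- The amplitudes of a state, as a function on binary words. -/
noncomputable def amp : Qubits ι ≃ₗ[ℂ] ((ι → ZMod 2) → ℂ) :=
  WithLp.linearEquiv 2 ℂ ((ι → Fin 2) → ℂ)

theorem amp_ext {ψ φ : Qubits ι} (h : ∀ b, amp ψ b = amp φ b) : ψ = φ :=
  amp.injective (funext h)

theorem exists_amp_ne_zero {ψ : Qubits ι} (h0 : ψ ≠ 0) : ∃ b, amp ψ b ≠ 0 :=
  Function.ne_iff.mp (amp.map_ne_zero_iff.mpr h0)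

variable [DecidableEq ι]

theorem amp_tensorOp (A : ι → Matrix (Fin 2) (Fin 2) ℂ) (ψ : Qubits ι) (b : ι → ZMod 2) :
    amp (tensorOp A ψ) b = ∑ b' : ι → ZMod 2, (∏ i, A i (b i) (b' i)) * amp ψ b' :=
  congrFun (Matrix.ofLp_toEuclideanCLM _ _) _

theorem amp_tensorOp_of_monomial {A : ι → Matrix (Fin 2) (Fin 2) ℂ} {b π : ι → ZMod 2}
    {c : ι → ℂ} (hA : ∀ i (s : ZMod 2), A i (b i) s = if s = π i then c i else 0) (ψ : Qubits ι) :
    amp (tensorOp A ψ) b = (∏ i, c i) * amp ψ π := by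
  have hprod (b' : ι → ZMod 2) : ∏ i, A i (b i) (b' i) = if b' = π then ∏ i, c i else 0 := by
    simp only [hA, Finset.prod_ite_zero, Finset.mem_univ, true_imp_iff, funext_iff]
  simp only [amp_tensorOp, hprod, ite_mul, zero_mul, Finset.sum_ite_eq', Finset.mem_univ, if_true]

theorem tensorOp_mul (A A' : ι → Matrix (Fin 2) (Fin 2) ℂ) :
    tensorOp A * tensorOp A' = tensorOp fun i => A i * A' i := by
  rw [tensorOp, tensorOp, tensorOp, ← map_mul]
  congr 1
  ext b b'
  simp only [Matrix.mul_apply, Matrix.of_apply, ← Finset.prod_mul_distrib, Finset.prod_univ_sum,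
    Fintype.piFinset_univ]

theorem isSelfAdjoint_tensorOp {A : ι → Matrix (Fin 2) (Fin 2) ℂ} (hA : ∀ i, (A i).IsHermitian) :
    IsSelfAdjoint (tensorOp A) := by
  rw [IsSelfAdjoint, tensorOp, ← map_star]
  congr 1
  ext b b'
  simp only [Matrix.star_apply, Matrix.of_apply, star_prod, (hA _).apply]

theorem amp_pauliX (v : ι → ZMod 2) (ψ : Qubits ι) (b : ι → ZMod 2) :
    amp (pauliX v ψ) b = amp ψ (b + v) := by
  have hentry : ∀ s t u : ZMod 2, (if s = 0 then 1 else !![0, 1; 1, 0] :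
      Matrix (Fin 2) (Fin 2) ℂ) t u = if u = t + s then 1 else 0 := by
    intro s t u
    fin_cases s <;> fin_cases t <;> fin_cases u <;> rfl
  rw [pauliX, amp_tensorOp_of_monomial fun i => hentry (v i) (b i), Finset.prod_const_one, one_mul]
  rfl

theorem amp_pauliZ (v : ι → ZMod 2) (ψ : Qubits ι) (b : ι → ZMod 2) :
    amp (pauliZ v ψ) b = phase (v ⬝ᵥ b) * amp ψ b := by
  have hentry : ∀ s t u : ZMod 2, (if s = 0 then 1 else !![1, 0; 0, -1] :
      Matrix (Fin 2) (Fin 2) ℂ) t u = if u = t then phase (s * t) else 0 := by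
    intro s t u
    fin_cases s <;> fin_cases t <;> fin_cases u <;>
      first | rfl | exact phase_one.symm
  rw [pauliZ, amp_tensorOp_of_monomial fun i => hentry (v i) (b i), phase_dotProduct]

theorem isSelfAdjoint_pauliX (v : ι → ZMod 2) : IsSelfAdjoint (pauliX v) :=
  isSelfAdjoint_tensorOp fun i => by
    split_ifs
    · exact Matrix.isHermitian_one
    · ext s t; fin_cases s <;> fin_cases t <;> simp

theorem isSelfAdjoint_pauliZ (v : ι → ZMod 2) : IsSelfAdjoint (pauliZ v) :=
  isSelfAdjoint_tensorOp fun i => by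
    split_ifs
    · exact Matrix.isHermitian_one
    · ext s t; fin_cases s <;> fin_cases t <;> simp

theorem pauliX_zero (ψ : Qubits ι) : pauliX 0 ψ = ψ :=
  amp_ext fun b => by rw [amp_pauliX, add_zero]

theorem pauliZ_zero (ψ : Qubits ι) : pauliZ 0 ψ = ψ :=
  amp_ext fun b => by rw [amp_pauliZ, zero_dotProduct, AddChar.map_zero_eq_one, one_mul]

theorem pauliX_pauliX (u v : ι → ZMod 2) (ψ : Qubits ι) :
    pauliX u (pauliX v ψ) = pauliX (u + v) ψ :=
  amp_ext fun b => by rw [amp_pauliX, amp_pauliX, amp_pauliX, add_assoc]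

theorem pauliZ_pauliZ (u v : ι → ZMod 2) (ψ : Qubits ι) :
    pauliZ u (pauliZ v ψ) = pauliZ (u + v) ψ :=
  amp_ext fun b => by
    rw [amp_pauliZ, amp_pauliZ, amp_pauliZ, add_dotProduct, AddChar.map_add_eq_mul, mul_assoc]

theorem pauliX_pauliX_self (v : ι → ZMod 2) (ψ : Qubits ι) : pauliX v (pauliX v ψ) = ψ := by
  rw [pauliX_pauliX, ZModModule.add_self, pauliX_zero]

theorem pauliZ_pauliZ_self (v : ι → ZMod 2) (ψ : Qubits ι) : pauliZ v (pauliZ v ψ) = ψ := by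
  rw [pauliZ_pauliZ, ZModModule.add_self, pauliZ_zero]

theorem pauliX_comm (u v : ι → ZMod 2) (ψ : Qubits ι) :
    pauliX u (pauliX v ψ) = pauliX v (pauliX u ψ) := by
  rw [pauliX_pauliX, add_comm, pauliX_pauliX]

theorem pauliZ_comm (u v : ι → ZMod 2) (ψ : Qubits ι) :
    pauliZ u (pauliZ v ψ) = pauliZ v (pauliZ u ψ) := by
  rw [pauliZ_pauliZ, add_comm, pauliZ_pauliZ]

theorem pauliX_pauliZ (u v : ι → ZMod 2) (ψ : Qubits ι) :
    pauliX u (pauliZ v ψ) = phase (u ⬝ᵥ v) • pauliZ v (pauliX u ψ) := by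
  refine amp_ext fun b => ?_
  simp only [map_smul, Pi.smul_apply, amp_pauliX, amp_pauliZ, dotProduct_add, dotProduct_comm v u,
    AddChar.map_add_eq_mul, smul_eq_mul]
  ring

theorem pauliZ_pauliX (u v : ι → ZMod 2) (ψ : Qubits ι) :
    pauliZ v (pauliX u ψ) = phase (u ⬝ᵥ v) • pauliX u (pauliZ v ψ) := by
  rw [pauliX_pauliZ, smul_smul, phase_mul_self, one_smul]

end Pauli

/-! ### Stabilizer codes -/

namespace CSSCode

variable {MX MZ ι : Type*} [Fintype ι] (Q : CSSCode MX MZ ι)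

theorem hX_dotProduct_hZ (i : MX) (j : MZ) : Q.hX i ⬝ᵥ Q.hZ j = 0 :=
  congrFun (congrFun Q.comm i) j

theorem hX_mem_dualCode (i : MX) : Q.hX i ∈ dualCode (kerCode Q.hX) :=
  fun _ hc => congrFun (mem_kerCode.mp hc) i

theorem dualCode_kerCode_hX_le : dualCode (kerCode Q.hX) ≤ kerCode Q.hZ := fun _ hv =>
  mem_kerCode.mpr <| funext fun j => (dotProduct_comm _ _).trans <|
    hv _ <| mem_kerCode.mpr <| funext fun i => Q.hX_dotProduct_hZ i j

variable [DecidableEq ι]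

theorem isSelfAdjoint_generator : ∀ s, IsSelfAdjoint (Q.generator s)
  | .inl i => isSelfAdjoint_pauliX (Q.hX i)
  | .inr j => isSelfAdjoint_pauliZ (Q.hZ j)

theorem generator_generator_self (ψ : Qubits ι) : ∀ s, Q.generator s (Q.generator s ψ) = ψ
  | .inl i => pauliX_pauliX_self (Q.hX i) ψ
  | .inr j => pauliZ_pauliZ_self (Q.hZ j) ψ

theorem generator_comm (ψ : Qubits ι) :
    ∀ s t, Q.generator s (Q.generator t ψ) = Q.generator t (Q.generator s ψ)
  | .inl i, .inl i' => pauliX_comm (Q.hX i) (Q.hX i') ψ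
  | .inl i, .inr j => by
    simp only [generator, pauliX_pauliZ, Q.hX_dotProduct_hZ, AddChar.map_zero_eq_one, one_smul]
  | .inr j, .inl i => by
    simp only [generator, pauliX_pauliZ, Q.hX_dotProduct_hZ, AddChar.map_zero_eq_one, one_smul]
  | .inr j, .inr j' => pauliZ_comm (Q.hZ j) (Q.hZ j') ψ

/-- The states with syndrome `σ`: each stabilizer generator `s` acts on them as `(-1) ^ σ s`. -/
noncomputable def syndromeSpace (σ : MX ⊕ MZ → ZMod 2) : Submodule ℂ (Qubits ι) :=
  ⨅ s, Module.End.eigenspace (Q.generator s : Qubits ι →ₗ[ℂ] Qubits ι) (phase (σ s))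

variable {Q}

theorem mem_syndromeSpace {σ : MX ⊕ MZ → ZMod 2} {ψ : Qubits ι} :
    ψ ∈ Q.syndromeSpace σ ↔ ∀ s, Q.generator s ψ = phase (σ s) • ψ := by
  simp only [syndromeSpace, Submodule.mem_iInf, Module.End.mem_eigenspace_iff,
    ContinuousLinearMap.coe_coe]

variable (Q)

theorem syndromeSpace_zero : Q.syndromeSpace 0 = Q.codeSpace := by
  ext ψ
  simp only [mem_syndromeSpace, Pi.zero_apply, AddChar.map_zero_eq_one, one_smul]
  rfl

theorem orthogonalFamily_syndromeSpace :
    OrthogonalFamily ℂ (fun σ => Q.syndromeSpace σ) fun σ => (Q.syndromeSpace σ).subtypeₗᵢ :=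
  (LinearMap.IsSymmetric.orthogonalFamily_iInf_eigenspaces fun s =>
    (Q.isSelfAdjoint_generator s).isSymmetric).comp
    (f := fun (σ : MX ⊕ MZ → ZMod 2) s => phase (σ s)) phase_injective.comp_left

theorem iSup_syndromeSpace : ⨆ σ, Q.syndromeSpace σ = ⊤ := by
  rw [eq_top_iff, ← LinearMap.IsSymmetric.iSup_iInf_eq_top_of_commute
    (fun s => (Q.isSelfAdjoint_generator s).isSymmetric)
    fun s t _ => LinearMap.ext fun ψ => Q.generator_comm ψ s t]
  refine iSup_le fun χ ψ hψ => ?_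
  simp only [Submodule.mem_iInf, Module.End.mem_eigenspace_iff, ContinuousLinearMap.coe_coe] at hψ
  by_cases h0 : ψ = 0
  · exact h0 ▸ Submodule.zero_mem _
  have hχ (s : MX ⊕ MZ) : ∃ a, phase a = χ s := by
    refine exists_phase_eq_of_mul_self_eq_one (smul_left_injective ℂ h0 ?_)
    simpa [hψ, smul_smul] using Q.generator_generator_self ψ s
  choose σ hσ using hχ
  exact Submodule.mem_iSup_of_mem σ (mem_syndromeSpace.mpr fun s => by rw [hσ, hψ])

theorem exists_sum_syndromeSpace_eq [Fintype (MX ⊕ MZ → ZMod 2)] (ψ : Qubits ι) :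
    ∃ l : ∀ σ, Q.syndromeSpace σ, ∑ σ, (l σ : Qubits ι) = ψ := by
  rw [← Submodule.mem_iSup_finset_iff_exists_sum, iSup_congr fun σ => iSup_pos (Finset.mem_univ σ),
    iSup_syndromeSpace]
  trivial

variable {Q} {σ : MX ⊕ MZ → ZMod 2} {ψ : Qubits ι}

theorem pauliX_mem_syndromeSpace (hψ : ψ ∈ Q.syndromeSpace σ) (a : ι → ZMod 2) :
    pauliX a ψ ∈ Q.syndromeSpace (σ + Sum.elim (0 : MX → ZMod 2) (Q.hZ *ᵥ a)) := by
  refine mem_syndromeSpace.mpr fun s => ?_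
  have hs := mem_syndromeSpace.mp hψ s
  rcases s with i | j <;> simp only [generator] at hs ⊢
  · rw [pauliX_comm, hs, map_smul, Pi.add_apply, Sum.elim_inl, Pi.zero_apply, add_zero]
  · rw [pauliZ_pauliX, hs, map_smul, smul_smul, Pi.add_apply, Sum.elim_inr, add_comm,
      AddChar.map_add_eq_mul, dotProduct_comm]
    rfl

theorem pauliZ_mem_syndromeSpace (hψ : ψ ∈ Q.syndromeSpace σ) (b : ι → ZMod 2) :
    pauliZ b ψ ∈ Q.syndromeSpace (σ + Sum.elim (Q.hX *ᵥ b) (0 : MZ → ZMod 2)) := by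
  refine mem_syndromeSpace.mpr fun s => ?_
  have hs := mem_syndromeSpace.mp hψ s
  rcases s with i | j <;> simp only [generator] at hs ⊢
  · rw [pauliX_pauliZ, hs, map_smul, smul_smul, Pi.add_apply, Sum.elim_inl, add_comm,
      AddChar.map_add_eq_mul]
    rfl
  · rw [pauliZ_comm, hs, map_smul, Pi.add_apply, Sum.elim_inr, Pi.zero_apply, add_zero]

theorem pauliX_vecMul_apply [Fintype MX] (hψ : ψ ∈ Q.syndromeSpace σ) (u : MX → ZMod 2) :
    pauliX (u ᵥ* Q.hX) ψ = phase (u ⬝ᵥ fun i => σ (.inl i)) • ψ := by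
  classical
  rw [Matrix.vecMul_eq_sum, dotProduct]
  induction (Finset.univ : Finset MX) using Finset.induction_on with
  | empty =>
    rw [Finset.sum_empty, Finset.sum_empty, pauliX_zero, AddChar.map_zero_eq_one, one_smul]
  | insert i S hi ih =>
    have hrow : pauliX (u i • Q.hX i) ψ = phase (u i * σ (.inl i)) • ψ := by
      by_cases hu : u i = 0
      · rw [hu, zero_smul, zero_mul, pauliX_zero, AddChar.map_zero_eq_one, one_smul]
      · have hu1 : u i = 1 := Fin.eq_one_of_ne_zero _ hu
        rw [hu1, one_smul, one_mul]
        exact mem_syndromeSpace.mp hψ (.inl i)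
    rw [Finset.sum_insert hi, Finset.sum_insert hi, ← pauliX_pauliX, ih, map_smul, hrow,
      smul_smul, mul_comm, AddChar.map_add_eq_mul]

theorem exists_mulVec_eq_of_mem_syndromeSpace [Finite MX] (hψ : ψ ∈ Q.syndromeSpace σ)
    (h0 : ψ ≠ 0) : ∃ b a, σ = Sum.elim (Q.hX *ᵥ b) (Q.hZ *ᵥ a) := by
  have := Fintype.ofFinite MX
  obtain ⟨b, hb⟩ : (fun i => σ (.inl i)) ∈ LinearMap.range Q.hX.mulVecLin := by
    rw [← dualCode_kerCode_transpose]
    intro u hu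
    rw [mem_kerCode, Matrix.mulVec_transpose] at hu
    have hfix := pauliX_vecMul_apply hψ u
    rw [hu, pauliX_zero] at hfix
    rw [dotProduct_comm]
    refine phase_injective (smul_left_injective ℂ h0 ?_)
    simp only [← hfix, AddChar.map_zero_eq_one, one_smul]
  obtain ⟨a, ha⟩ := exists_amp_ne_zero h0
  refine ⟨b, a, funext ?_⟩
  rintro (i | j)
  · exact (congrFun hb i).symm
  · have hj := congrArg (amp · a) (mem_syndromeSpace.mp hψ (.inr j))
    simp only [generator, amp_pauliZ, map_smul, Pi.smul_apply, smul_eq_mul] at hj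
    exact (phase_injective (mul_right_cancel₀ ha hj)).symm

end CSSCode

theorem fattening_mono {ι : Type*} [Fintype ι] [DecidableEq ι] (S : Submodule ℂ (Qubits ι)) :
    Monotone (fattening S) := fun _ _ hst =>
  Submodule.span_mono fun _ ⟨A, hA, hψ⟩ => ⟨A, hA.trans hst, hψ⟩

theorem mem_fattening_of_pauli_mem {ι : Type*} [Fintype ι] [DecidableEq ι]
    {S : Submodule ℂ (Qubits ι)} {a b : ι → ZMod 2} {ψ : Qubits ι}
    (hψ : pauliX a (pauliZ b ψ) ∈ S) : ψ ∈ fattening S (hammingNorm b + hammingNorm a) := by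
  let A : ι → Matrix (Fin 2) (Fin 2) ℂ := fun i =>
    (if b i = 0 then 1 else !![1, 0; 0, -1]) * (if a i = 0 then 1 else !![0, 1; 1, 0])
  have hA : tensorOp A = pauliZ b * pauliX a := (tensorOp_mul _ _).symm
  have hsupp : {i | A i ≠ 1} ⊆ ((Finset.univ.filter (b · ≠ 0) ∪ Finset.univ.filter (a · ≠ 0) :
      Finset ι) : Set ι) := by
    intro i hi
    by_contra h
    simp only [Finset.coe_union, Finset.coe_filter, Finset.mem_univ, true_and, Set.mem_union,
      Set.mem_ofPred_eq, not_or, not_not] at h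
    simp [A, h.1, h.2] at hi
  refine Submodule.subset_span ⟨A, ?_, _, hψ, ?_⟩
  · refine (Set.ncard_le_ncard hsupp (Finset.finite_toSet _)).trans ?_
    rw [Set.ncard_coe_finset]
    exact Finset.card_union_le _ _
  · rw [hA, mul_apply_eq_comp, pauliX_pauliX_self, pauliZ_pauliZ_self]

namespace CSSCode

variable {MX MZ ι : Type*} [Fintype ι] [DecidableEq ι] {Q : CSSCode MX MZ ι}

theorem mem_fattening_of_mem_syndromeSpace {b a : ι → ZMod 2} {ψ : Qubits ι}
    (hψ : ψ ∈ Q.syndromeSpace (Sum.elim (Q.hX *ᵥ b) (Q.hZ *ᵥ a))) :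
    ψ ∈ fattening Q.codeSpace (distTo b (kerCode Q.hX) + distTo a (kerCode Q.hZ)) := by
  obtain ⟨z, hz, hzb⟩ := exists_add_mem_hammingNorm_eq_distTo b (kerCode Q.hX)
  obtain ⟨y, hy, hya⟩ := exists_add_mem_hammingNorm_eq_distTo a (kerCode Q.hZ)
  rw [← hzb, ← hya]
  refine mem_fattening_of_pauli_mem ?_
  rw [← Q.syndromeSpace_zero]
  convert pauliX_mem_syndromeSpace (pauliZ_mem_syndromeSpace hψ z) y using 2
  rw [← Sum.elim_add_add, ← Sum.elim_add_add, ← Matrix.mulVec_add, add_zero, add_zero,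
    ← Matrix.mulVec_add, mem_kerCode.mp hz, mem_kerCode.mp hy, Sum.elim_zero_zero]

end CSSCode

/-! ### The dimension of the code space -/

namespace CSSCode

variable {MX MZ ι : Type*} [Fintype ι]

/-- The classes of `X`-type logical operators: words commuting with every `Z`-check, modulo the
words orthogonal to `ker H_X`, that is, modulo the `X`-stabilizers. -/
abbrev logicalClasses (Q : CSSCode MX MZ ι) : Type _ :=
  kerCode Q.hZ ⧸ (dualCode (kerCode Q.hX)).submoduleOf (kerCode Q.hZ)

variable (Q : CSSCode MX MZ ι)

theorem mk_eq_mk_iff {b b' : kerCode Q.hZ} :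
    (Submodule.Quotient.mk b : Q.logicalClasses) = Submodule.Quotient.mk b' ↔
      (b : ι → ZMod 2) + b' ∈ dualCode (kerCode Q.hX) := by
  rw [Submodule.Quotient.eq, Submodule.submoduleOf, Submodule.mem_comap, map_sub,
    ZModModule.sub_eq_add]
  rfl

variable [DecidableEq ι] [Finite MX]

theorem mem_codeSpace_iff {ψ : Qubits ι} :
    ψ ∈ Q.codeSpace ↔ (∀ b ∉ kerCode Q.hZ, amp ψ b = 0) ∧
      ∀ v ∈ dualCode (kerCode Q.hX), ∀ b, amp ψ (b + v) = amp ψ b := by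
  have := Fintype.ofFinite MX
  constructor
  · intro hψ
    constructor
    · intro b hb
      obtain ⟨j, hj⟩ : ∃ j, (Q.hZ *ᵥ b) j ≠ 0 := Function.ne_iff.mp (mt mem_kerCode.mpr hb)
      have hfix := congrArg (amp · b) (hψ (.inr j))
      simp only [generator, amp_pauliZ] at hfix
      rw [show phase (Q.hZ j ⬝ᵥ b) = -1 from phase_of_ne_zero hj, neg_one_mul] at hfix
      exact neg_eq_self.mp hfix
    · intro v hv b
      rw [dualCode_kerCode] at hv
      obtain ⟨u, rfl⟩ := hv
      rw [← syndromeSpace_zero] at hψ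
      have hfix := pauliX_vecMul_apply hψ u
      rw [show (fun i => (0 : MX ⊕ MZ → ZMod 2) (.inl i)) = 0 from rfl, dotProduct_zero,
        AddChar.map_zero_eq_one, one_smul] at hfix
      rw [← amp_pauliX, Matrix.vecMulLinear_apply, hfix]
  · rintro ⟨hsupp, hinv⟩ (i | j) <;> refine amp_ext fun b => ?_
    · exact (amp_pauliX _ _ _).trans (hinv _ (Q.hX_mem_dualCode i) b)
    · refine (amp_pauliZ _ _ _).trans ?_
      by_cases hb : b ∈ kerCode Q.hZ
      · rw [show Q.hZ j ⬝ᵥ b = 0 from congrFun (mem_kerCode.mp hb) j, AddChar.map_zero_eq_one,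
          one_mul]
      · rw [hsupp b hb, mul_zero]

open Classical in
/-- The code state whose amplitudes are constant on each class of logical operators, with the
given values. -/
noncomputable def codeState : (Q.logicalClasses → ℂ) →ₗ[ℂ] Q.codeSpace :=
  LinearMap.codRestrict Q.codeSpace
    (amp.symm.toLinearMap ∘ₗ LinearMap.pi fun b =>
      if hb : b ∈ kerCode Q.hZ then LinearMap.proj (Submodule.Quotient.mk ⟨b, hb⟩) else 0)
    (by
      intro g
      refine (Q.mem_codeSpace_iff).mpr ⟨fun b hb => ?_, fun v hv b => ?_⟩
      · simp [hb]
      · have hvZ := Q.dualCode_kerCode_hX_le hv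
        by_cases hb : b ∈ kerCode Q.hZ
        · have hmk : (Submodule.Quotient.mk ⟨b + v, add_mem hb hvZ⟩ : Q.logicalClasses) =
              Submodule.Quotient.mk ⟨b, hb⟩ := by
            rwa [mk_eq_mk_iff, add_right_comm, ZModModule.add_self, zero_add]
          simp [hb, add_mem hb hvZ, hmk]
        · have hbv : b + v ∉ kerCode Q.hZ := mt (Submodule.add_mem_iff_left _ hvZ).mp hb
          simp [hb, hbv])

theorem amp_codeState (g : Q.logicalClasses → ℂ) (b : kerCode Q.hZ) :
    amp (Q.codeState g : Qubits ι) b = g (Submodule.Quotient.mk b) := by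
  simp [codeState]

theorem codeState_bijective : Function.Bijective Q.codeState := by
  constructor
  · intro g g' hgg'
    ext c
    obtain ⟨b, rfl⟩ := Submodule.Quotient.mk_surjective _ c
    rw [← Q.amp_codeState g, hgg', amp_codeState]
  · rintro ⟨ψ, hψ⟩
    obtain ⟨hsupp, hinv⟩ := Q.mem_codeSpace_iff.mp hψ
    refine ⟨fun c => Quotient.liftOn' c (fun b => amp ψ b) fun b b' hbb' => ?_, ?_⟩
    · have hbb' : (b : ι → ZMod 2) + b' ∈ dualCode (kerCode Q.hX) :=
        Q.mk_eq_mk_iff.mp (Quotient.sound' hbb')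
      rw [← hinv _ hbb' b', add_comm (b : ι → ZMod 2), ← add_assoc, ZModModule.add_self, zero_add]
    · refine Subtype.ext (amp_ext fun b => ?_)
      by_cases hb : b ∈ kerCode Q.hZ
      · exact Q.amp_codeState _ ⟨b, hb⟩
      · rw [hsupp b hb, (Q.mem_codeSpace_iff.mp (Q.codeState _).2).1 b hb]

theorem finrank_codeSpace :
    Module.finrank ℂ Q.codeSpace = 2 ^ Module.finrank (ZMod 2) Q.logicalClasses := by
  classical
  have : Fintype Q.logicalClasses := Fintype.ofFinite _
  rw [← (LinearEquiv.ofBijective Q.codeState Q.codeState_bijective).finrank_eq,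
    Module.finrank_fintype_fun_eq_card, Module.card_eq_pow_finrank (K := ZMod 2), ZMod.card]

end CSSCode

/-! ### Quantum soundness from classical soundness -/

theorem sum_Icc_smul_sub {E : Type*} [AddCommGroup E] (P : ℕ → E) (N : ℕ) :
    ∑ t ∈ Finset.Icc 1 N, t • (P t - P (t - 1)) = ∑ t ∈ Finset.range N, (P N - P t) := by
  induction N with
  | zero => rfl
  | succ N ih =>
    rw [Finset.sum_Icc_succ_top (Nat.le_add_left 1 N), ih, Finset.sum_range_succ,
      Nat.add_sub_cancel, Finset.sum_sub_distrib, Finset.sum_sub_distrib, Finset.sum_const,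
      Finset.sum_const, Finset.card_range, succ_nsmul, smul_sub]
    abel

theorem norm_sq_sub_norm_sq_starProjection_le {𝕜 E : Type*} [RCLike 𝕜] [NormedAddCommGroup E]
    [InnerProductSpace 𝕜 E] (K : Submodule 𝕜 E) [K.HasOrthogonalProjection] (x : E) {y : E}
    (hy : y ∈ K) : ‖x‖ ^ 2 - ‖K.starProjection x‖ ^ 2 ≤ ‖x - y‖ ^ 2 := by
  have horth : Kᗮ.starProjection x = Kᗮ.starProjection (x - y) := by
    rw [map_sub, Submodule.starProjection_orthogonal_apply_eq_zero hy, sub_zero]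
  rw [Submodule.norm_sq_eq_add_norm_sq_starProjection x K, add_sub_cancel_left, horth]
  gcongr
  exact Submodule.norm_starProjection_apply_le _ _

section DistanceOp

variable {ι κ : Type*} [Fintype ι] [DecidableEq ι] [Fintype κ] (S : Submodule ℂ (Qubits ι))

theorem distanceOp_eq_sum : distanceOp S = ∑ t ∈ Finset.range (Fintype.card ι),
    ((fattening S (Fintype.card ι)).starProjection - (fattening S t).starProjection) := by
  simp only [distanceOp, Nat.cast_smul_eq_nsmul]
  exact sum_Icc_smul_sub (fun t => (fattening S t).starProjection) _

theorem isSelfAdjoint_distanceOp : IsSelfAdjoint (distanceOp S) := by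
  rw [distanceOp_eq_sum]
  refine isSelfAdjoint_sum (R := Qubits ι →L[ℂ] Qubits ι) _ fun t _ => ?_
  exact (isSelfAdjoint_starProjection _).sub (isSelfAdjoint_starProjection _)

theorem re_inner_distanceOp_le_sum (ψ : Qubits ι) :
    (inner ℂ (distanceOp S ψ) ψ).re ≤
      ∑ t ∈ Finset.range (Fintype.card ι), (‖ψ‖ ^ 2 - ‖(fattening S t).starProjection ψ‖ ^ 2) := by
  rw [distanceOp_eq_sum, sum_apply, sum_inner, Complex.re_sum]
  refine Finset.sum_le_sum fun t _ => ?_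
  rw [sub_apply, inner_sub_left, Complex.sub_re]
  have hnorm (r : ℕ) : (inner ℂ ((fattening S r).starProjection ψ) ψ).re =
      ‖(fattening S r).starProjection ψ‖ ^ 2 :=
    Submodule.re_inner_starProjection_eq_normSq (K := fattening S r) ψ
  rw [hnorm, hnorm]
  gcongr
  exact Submodule.norm_starProjection_apply_le _ _

variable {S} {V : κ → Submodule ℂ (Qubits ι)} {l : ∀ σ, V σ} {δ : κ → ℕ}

theorem norm_sq_sub_norm_sq_starProjection_fattening_le
    (hV : OrthogonalFamily ℂ (fun σ => V σ) fun σ => (V σ).subtypeₗᵢ)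
    (hδ : ∀ σ, (l σ : Qubits ι) ∈ fattening S (δ σ)) (t : ℕ) :
    ‖∑ σ, (l σ : Qubits ι)‖ ^ 2 - ‖(fattening S t).starProjection (∑ σ, (l σ : Qubits ι))‖ ^ 2 ≤
      ∑ σ, if t < δ σ then ‖l σ‖ ^ 2 else 0 := by
  have hnear : ∑ σ, (if t < δ σ then 0 else (l σ : Qubits ι)) ∈ fattening S t :=
    Submodule.sum_mem _ fun σ _ => by
      split_ifs with hσ
      · exact Submodule.zero_mem _
      · exact fattening_mono S (not_lt.mp hσ) (hδ σ)
  refine (norm_sq_sub_norm_sq_starProjection_le _ _ hnear).trans_eq ?_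
  have hfar : ∑ σ, (l σ : Qubits ι) - ∑ σ, (if t < δ σ then 0 else (l σ : Qubits ι)) =
      ∑ σ, (V σ).subtypeₗᵢ (if t < δ σ then l σ else 0) := by
    rw [← Finset.sum_sub_distrib]
    refine Finset.sum_congr rfl fun σ _ => ?_
    split_ifs <;> simp
  rw [hfar, hV.norm_sum]
  refine Finset.sum_congr rfl fun σ _ => ?_
  split_ifs <;> simp

theorem re_inner_distanceOp_le
    (hV : OrthogonalFamily ℂ (fun σ => V σ) fun σ => (V σ).subtypeₗᵢ)
    (hδ : ∀ σ, (l σ : Qubits ι) ∈ fattening S (δ σ)) :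
    (inner ℂ (distanceOp S (∑ σ, (l σ : Qubits ι))) (∑ σ, (l σ : Qubits ι))).re ≤
      ∑ σ, δ σ * ‖l σ‖ ^ 2 := by
  set n := Fintype.card ι
  calc _ ≤ ∑ t ∈ Finset.range n, ∑ σ, if t < δ σ then ‖l σ‖ ^ 2 else 0 :=
        (re_inner_distanceOp_le_sum S _).trans <| Finset.sum_le_sum fun t _ =>
          norm_sq_sub_norm_sq_starProjection_fattening_le hV hδ t
    _ = ∑ σ, ((Finset.range n).filter (· < δ σ)).card * ‖l σ‖ ^ 2 := by
        rw [Finset.sum_comm]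
        simp only [← Finset.sum_filter, Finset.sum_const, nsmul_eq_mul]
    _ ≤ ∑ σ, δ σ * ‖l σ‖ ^ 2 := by
        gcongr with σ
        refine (Finset.card_le_card fun t ht => ?_).trans_eq (Finset.card_range (δ σ))
        exact Finset.mem_range.mpr (Finset.mem_filter.mp ht).2

end DistanceOp

namespace CSSCode

variable {MX MZ ι : Type*} [Fintype MX] [Fintype MZ] [Fintype ι] [DecidableEq ι]
  (Q : CSSCode MX MZ ι)

/-- The sum of the projectors `(1 - S) / 2` over the stabilizer generators `S`. -/
noncomputable def hamiltonian : Qubits ι →L[ℂ] Qubits ι :=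
  ∑ s, (1 / 2 : ℂ) • (1 - Q.generator s)

theorem isSelfAdjoint_hamiltonian : IsSelfAdjoint Q.hamiltonian := by
  have hhalf : IsSelfAdjoint (1 / 2 : ℂ) := by simp
  refine isSelfAdjoint_sum (R := Qubits ι →L[ℂ] Qubits ι) _ fun s _ => ?_
  exact hhalf.smul ((IsSelfAdjoint.one _).sub (Q.isSelfAdjoint_generator s))

variable {Q}

theorem hamiltonian_apply_of_mem_syndromeSpace {σ : MX ⊕ MZ → ZMod 2} {ψ : Qubits ι}
    (hψ : ψ ∈ Q.syndromeSpace σ) : Q.hamiltonian ψ = (hammingNorm σ : ℂ) • ψ := by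
  rw [hamiltonian, sum_apply, hammingNorm_eq_sum, Nat.cast_sum, Finset.sum_smul]
  refine Finset.sum_congr rfl fun s _ => ?_
  rw [smul_apply, sub_apply, mem_syndromeSpace.mp hψ s, one_apply_eq_self]
  by_cases hs : σ s = 0
  · simp [hs]
  · rw [phase_of_ne_zero hs, if_pos hs, neg_one_smul, sub_neg_eq_add, ← two_smul ℂ, smul_smul]
    norm_num

theorem re_inner_hamiltonian [Fintype (MX ⊕ MZ → ZMod 2)] (l : ∀ σ, Q.syndromeSpace σ) :
    (inner ℂ (Q.hamiltonian (∑ σ, (l σ : Qubits ι))) (∑ σ, (l σ : Qubits ι))).re =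
      ∑ σ, hammingNorm σ * ‖l σ‖ ^ 2 := by
  rw [map_sum]
  simp only [hamiltonian_apply_of_mem_syndromeSpace (l _).2]
  have hdiag := Q.orthogonalFamily_syndromeSpace.inner_sum
    (fun σ => (hammingNorm σ : ℂ) • l σ) l Finset.univ
  simp only [map_smul] at hdiag
  refine (congrArg Complex.re hdiag).trans ?_
  rw [Complex.re_sum]
  refine Finset.sum_congr rfl fun σ _ => ?_
  change (inner ℂ ((hammingNorm σ : ℂ) • (l σ : Qubits ι)) (l σ : Qubits ι)).re =
    hammingNorm σ * ‖(l σ : Qubits ι)‖ ^ 2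
  rw [inner_smul_left, inner_self_eq_norm_sq_to_K, ← Complex.ofReal_natCast, Complex.conj_ofReal,
    Complex.re_ofReal_mul]
  norm_cast

theorem exists_mem_fattening_of_mem_syndromeSpace {α β : ℝ} (hβ : 0 ≤ β)
    (h : ∀ b a : ι → ZMod 2, α * (distTo b (kerCode Q.hX) + distTo a (kerCode Q.hZ)) ≤
      β * (hammingNorm (Q.hX *ᵥ b) + hammingNorm (Q.hZ *ᵥ a)))
    {σ : MX ⊕ MZ → ZMod 2} {ψ : Qubits ι} (hψ : ψ ∈ Q.syndromeSpace σ) :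
    ∃ δ : ℕ, ψ ∈ fattening Q.codeSpace δ ∧ α * δ ≤ β * hammingNorm σ := by
  by_cases h0 : ψ = 0
  · exact ⟨0, h0 ▸ Submodule.zero_mem _, by rw [Nat.cast_zero, mul_zero]; positivity⟩
  obtain ⟨b, a, rfl⟩ := exists_mulVec_eq_of_mem_syndromeSpace hψ h0
  refine ⟨_, mem_fattening_of_mem_syndromeSpace hψ, ?_⟩
  rw [hammingNorm_sum_type]
  exact_mod_cast h b a

theorem isPositive_of_distTo_le {α β : ℝ} (hα : 0 ≤ α) (hβ : 0 ≤ β)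
    (h : ∀ b a : ι → ZMod 2, α * (distTo b (kerCode Q.hX) + distTo a (kerCode Q.hZ)) ≤
      β * (hammingNorm (Q.hX *ᵥ b) + hammingNorm (Q.hZ *ᵥ a))) :
    ((β : ℂ) • Q.hamiltonian - (α : ℂ) • distanceOp Q.codeSpace).IsPositive := by
  classical
  have hreal (r : ℝ) : IsSelfAdjoint (r : ℂ) := Complex.conj_ofReal r
  have hsym : IsSelfAdjoint ((β : ℂ) • Q.hamiltonian - (α : ℂ) • distanceOp Q.codeSpace) :=
    IsSelfAdjoint.sub (R := Qubits ι →L[ℂ] Qubits ι)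
      ((hreal β).smul Q.isSelfAdjoint_hamiltonian)
      ((hreal α).smul (isSelfAdjoint_distanceOp Q.codeSpace))
  refine ⟨hsym.isSymmetric, fun ψ => ?_⟩
  obtain ⟨l, rfl⟩ := Q.exists_sum_syndromeSpace_eq ψ
  choose δ hδ hδle using fun σ => exists_mem_fattening_of_mem_syndromeSpace hβ h (l σ).2
  rw [ContinuousLinearMap.reApplyInnerSelf_apply, sub_apply, smul_apply, smul_apply, inner_sub_left,
    inner_smul_left, inner_smul_left, Complex.conj_ofReal, Complex.conj_ofReal, map_sub,
    RCLike.re_to_complex, RCLike.re_to_complex, Complex.re_ofReal_mul, Complex.re_ofReal_mul,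
    sub_nonneg]
  rw [re_inner_hamiltonian]
  have hD := re_inner_distanceOp_le Q.orthogonalFamily_syndromeSpace hδ
  refine (mul_le_mul_of_nonneg_left hD hα).trans ?_
  simp only [Finset.mul_sum, ← mul_assoc]
  gcongr ∑ σ, ?_ * _ with σ
  exact hδle σ

theorem isQLTC_of_isLTC [Nonempty (MX ⊕ MZ)] [Nonempty ι] {ρ ρX ρZ : ℝ} {w : ℕ} (hρ : 0 ≤ ρ)
    (hX : IsLTC Q.hX ρX w) (hZ : IsLTC Q.hZ ρZ w)
    (hρX : ρ * Fintype.card (MX ⊕ MZ) ≤ ρX * Fintype.card MX)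
    (hρZ : ρ * Fintype.card (MX ⊕ MZ) ≤ ρZ * Fintype.card MZ) : Q.IsQLTC ρ w := by
  refine ⟨Sum.rec hX.1 hZ.1, ?_⟩
  have hM : (0 : ℝ) < Fintype.card (MX ⊕ MZ) := Nat.cast_pos.mpr Fintype.card_pos
  have hι : (0 : ℝ) < Fintype.card ι := Nat.cast_pos.mpr Fintype.card_pos
  have hpos := isPositive_of_distTo_le (Q := Q) (α := ρ / Fintype.card ι)
    (β := 1 / Fintype.card (MX ⊕ MZ)) (by positivity) (by positivity) fun b a => by
      rw [div_mul_eq_mul_div, div_mul_eq_mul_div, div_le_div_iff₀ hι hM, one_mul]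
      have hb : ρ * Fintype.card (MX ⊕ MZ) * distTo b (kerCode Q.hX) ≤
          Fintype.card ι * hammingNorm (Q.hX *ᵥ b) :=
        (mul_le_mul_of_nonneg_right hρX (Nat.cast_nonneg _)).trans ((isLTC_iff.mp hX).2 b)
      have ha : ρ * Fintype.card (MX ⊕ MZ) * distTo a (kerCode Q.hZ) ≤
          Fintype.card ι * hammingNorm (Q.hZ *ᵥ a) :=
        (mul_le_mul_of_nonneg_right hρZ (Nat.cast_nonneg _)).trans ((isLTC_iff.mp hZ).2 a)
      linarith
  rwa [Complex.ofReal_div, Complex.ofReal_one, Complex.ofReal_natCast] at hpos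

end CSSCode

/-! ### Distance balancing by a star -/

section StarIncidence

variable {p : ℕ}

/-- The incidence matrix of the star with `p` edges, with vertices and edges indexed so that no
truncated subtraction occurs. -/
def starIncidence (p : ℕ) : Matrix (Fin (p + 1)) (Fin p) (ZMod 2) := starMatrix (p + 1)

theorem starIncidence_castSucc (v e : Fin p) :
    starIncidence p v.castSucc e = if v = e then 1 else 0 := by
  have hv : (v : ℕ) ≠ p := v.is_lt.ne
  simp [starIncidence, starMatrix, hv, Fin.ext_iff]

theorem starIncidence_last (e : Fin p) : starIncidence p (Fin.last p) e = 1 := by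
  simp [starIncidence, starMatrix]

theorem rowWeight_starIncidence_castSucc (v : Fin p) :
    rowWeight (starIncidence p) v.castSucc = 1 := by
  simp [rowWeight, hammingNorm_eq_sum, starIncidence_castSucc]

theorem rowWeight_starIncidence_last : rowWeight (starIncidence p) (Fin.last p) = p := by
  simp [rowWeight, hammingNorm_eq_sum, starIncidence_last]

theorem colWeight_starIncidence (e : Fin p) : colWeight (starIncidence p) e = 2 := by
  simp [colWeight, hammingNorm_eq_sum, Fin.sum_univ_castSucc, starIncidence_castSucc,
    starIncidence_last]

end StarIncidence

section Blocks

variable {MX ι : Type*} {p : ℕ}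

/-- The block at the vertex `v` of the star of a word of a star-balanced code. -/
def vertexBlock (v : Fin (p + 1)) :
    ((ι × Fin (p + 1)) ⊕ (MX × Fin p) → ZMod 2) →ₗ[ZMod 2] (ι → ZMod 2) :=
  LinearMap.funLeft _ _ fun a => .inl (a, v)

/-- The block at the edge `e` of the star of a word of a star-balanced code. -/
def edgeBlock (e : Fin p) :
    ((ι × Fin (p + 1)) ⊕ (MX × Fin p) → ZMod 2) →ₗ[ZMod 2] (MX → ZMod 2) :=
  LinearMap.funLeft _ _ fun i => .inr (i, e)

/-- The sum of the vertex blocks. It carries the logical content of a word of `ker H_X`, whereas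
that of a word of `ker H_Z` is carried by the block at the centre of the star. -/
def vertexSum : ((ι × Fin (p + 1)) ⊕ (MX × Fin p) → ZMod 2) →ₗ[ZMod 2] (ι → ZMod 2) :=
  ∑ v, vertexBlock v

/-- The word of a star-balanced code with vertex blocks `x` and edge blocks `y`. -/
def ofBlocks (x : Fin (p + 1) → ι → ZMod 2) (y : Fin p → MX → ZMod 2) :
    (ι × Fin (p + 1)) ⊕ (MX × Fin p) → ZMod 2 :=
  Sum.elim (fun a => x a.2 a.1) fun i => y i.2 i.1

theorem vertexBlock_ofBlocks (x : Fin (p + 1) → ι → ZMod 2) (y : Fin p → MX → ZMod 2)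
    (v : Fin (p + 1)) : vertexBlock v (ofBlocks x y) = x v :=
  rfl

theorem edgeBlock_ofBlocks (x : Fin (p + 1) → ι → ZMod 2) (y : Fin p → MX → ZMod 2) (e : Fin p) :
    edgeBlock e (ofBlocks x y) = y e :=
  rfl

theorem vertexSum_eq_sum (q : (ι × Fin (p + 1)) ⊕ (MX × Fin p) → ZMod 2) :
    vertexSum q = ∑ v, vertexBlock v q :=
  LinearMap.sum_apply _ _ _

variable [Fintype ι] [Fintype MX]

theorem hammingNorm_eq_sum_blocks (q : (ι × Fin (p + 1)) ⊕ (MX × Fin p) → ZMod 2) :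
    hammingNorm q = ∑ v, hammingNorm (vertexBlock v q) + ∑ e, hammingNorm (edgeBlock e q) := by
  rw [hammingNorm_sum_type, hammingNorm_prod_type, hammingNorm_prod_type]
  rfl

theorem dotProduct_eq_sum_blocks (q q' : (ι × Fin (p + 1)) ⊕ (MX × Fin p) → ZMod 2) :
    q ⬝ᵥ q' = ∑ v, vertexBlock v q ⬝ᵥ vertexBlock v q' + ∑ e, edgeBlock e q ⬝ᵥ edgeBlock e q' := by
  simp only [dotProduct, Fintype.sum_sum_type, Fintype.sum_prod_type_right]
  rfl

theorem hammingNorm_vertexSum_le (q : (ι × Fin (p + 1)) ⊕ (MX × Fin p) → ZMod 2) :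
    hammingNorm (vertexSum q) ≤ hammingNorm q := by
  rw [hammingNorm_eq_sum_blocks, vertexSum_eq_sum]
  exact (hammingNorm_finset_sum_le _ _).trans (Nat.le_add_right _ _)

end Blocks

namespace CSSCode

variable {MX MZ ι : Type*} [Fintype MX] [DecidableEq MX] [DecidableEq MZ] [Fintype ι]
  [DecidableEq ι] (Q : CSSCode MX MZ ι) (p : ℕ)

/-- Distance balancing by the star with `p` edges. -/
def starBalance : CSSCode (MX × Fin (p + 1)) ((ι × Fin p) ⊕ (MZ × Fin (p + 1)))
    ((ι × Fin (p + 1)) ⊕ (MX × Fin p)) :=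
  distanceBalance Q (starIncidence p)

variable {p} (q : (ι × Fin (p + 1)) ⊕ (MX × Fin p) → ZMod 2)

theorem starBalance_hX_mulVec (v : Fin (p + 1)) :
    (fun i => ((Q.starBalance p).hX *ᵥ q) (i, v)) =
      Q.hX *ᵥ vertexBlock v q + ∑ e, starIncidence p v e • edgeBlock e q := by
  ext i
  simp [starBalance, distanceBalance, Matrix.mulVec, dotProduct, Fintype.sum_prod_type,
    Matrix.one_apply, vertexBlock, edgeBlock, LinearMap.funLeft_apply]

theorem starBalance_hX_mulVec_castSucc (e : Fin p) :
    (fun i => ((Q.starBalance p).hX *ᵥ q) (i, e.castSucc)) =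
      Q.hX *ᵥ vertexBlock e.castSucc q + edgeBlock e q := by
  simp [starBalance_hX_mulVec, starIncidence_castSucc]

theorem starBalance_hX_mulVec_last :
    (fun i => ((Q.starBalance p).hX *ᵥ q) (i, Fin.last p)) =
      Q.hX *ᵥ vertexBlock (Fin.last p) q + ∑ e, edgeBlock e q := by
  simp [starBalance_hX_mulVec, starIncidence_last]

theorem starBalance_hZ_mulVec_inl (e : Fin p) :
    (fun a => ((Q.starBalance p).hZ *ᵥ q) (.inl (a, e))) =
      vertexBlock e.castSucc q + vertexBlock (Fin.last p) q + edgeBlock e q ᵥ* Q.hX := by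
  ext a
  simp [starBalance, distanceBalance, Matrix.mulVec, Matrix.vecMul, dotProduct,
    Fintype.sum_prod_type, Matrix.one_apply, Fin.sum_univ_castSucc, starIncidence_castSucc,
    starIncidence_last, vertexBlock, edgeBlock, LinearMap.funLeft_apply, mul_comm]

theorem starBalance_hZ_mulVec_inr (v : Fin (p + 1)) :
    (fun j => ((Q.starBalance p).hZ *ᵥ q) (.inr (j, v))) = Q.hZ *ᵥ vertexBlock v q := by
  ext j
  simp [starBalance, distanceBalance, Matrix.mulVec, dotProduct, Fintype.sum_prod_type,
    Matrix.one_apply, vertexBlock, LinearMap.funLeft_apply]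

end CSSCode

/-! ### Logical operators of a star-balanced code -/

/-- The weights of the words of `C` that are not orthogonal to `C'`. -/
def nontrivialWeights {ι : Type*} [Fintype ι] (C C' : Submodule (ZMod 2) (ι → ZMod 2)) : Set ℕ :=
  {t | ∃ c ∈ C, c ∉ dualCode C' ∧ hammingNorm c = t}

theorem isLeast_nontrivialWeights_iff {ι : Type*} [Fintype ι]
    {C C' : Submodule (ZMod 2) (ι → ZMod 2)} {d : ℕ} :
    IsLeast (nontrivialWeights C C') d ↔ (∃ c ∈ C, c ∉ dualCode C' ∧ hammingNorm c = d) ∧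
      ∀ c ∈ C, c ∉ dualCode C' → d ≤ hammingNorm c :=
  and_congr_right fun _ =>
    ⟨fun h c hc hc' => h ⟨c, hc, hc', rfl⟩, fun h _ ⟨c, hc, hc', hw⟩ => hw ▸ h c hc hc'⟩

theorem finrank_quotient_eq_of_comap_eq {K W W' : Type*} [Ring K] [AddCommGroup W]
    [AddCommGroup W'] [Module K W] [Module K W'] {f : W →ₗ[K] W'} (hf : Function.Surjective f)
    {P : Submodule K W} {P' : Submodule K W'} (hP : P'.comap f = P) :
    Module.finrank K (W ⧸ P) = Module.finrank K (W' ⧸ P') := by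
  have hker : P = LinearMap.ker (P'.mkQ ∘ₗ f) := by rw [LinearMap.ker_comp, P'.ker_mkQ, hP]
  exact ((Submodule.quotEquivOfEq _ _ hker).trans <| LinearMap.quotKerEquivOfSurjective _ <|
    (Submodule.mkQ_surjective P').comp hf).finrank_eq

namespace CSSCode

section

variable {MX MZ ι : Type*} [Fintype ι] {Q : CSSCode MX MZ ι}

theorem isLeast_logicalWeights {d d' : ℕ}
    (hX : IsLeast (nontrivialWeights (kerCode Q.hX) (kerCode Q.hZ)) d)
    (hZ : IsLeast (nontrivialWeights (kerCode Q.hZ) (kerCode Q.hX)) d') :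
    IsLeast Q.logicalWeights (min d d') :=
  hX.union hZ

variable [Fintype MX]

variable (Q)

theorem vecMul_hX_mem_dualCode (y : MX → ZMod 2) : y ᵥ* Q.hX ∈ dualCode (kerCode Q.hX) := by
  rw [dualCode_kerCode]
  exact ⟨y, rfl⟩

theorem hZ_mulVec_vecMul_hX (y : MX → ZMod 2) : Q.hZ *ᵥ (y ᵥ* Q.hX) = 0 :=
  mem_kerCode.mp (Q.dualCode_kerCode_hX_le (Q.vecMul_hX_mem_dualCode y))

end

variable {MX MZ ι : Type*} [Fintype MX] [DecidableEq MX] [DecidableEq MZ] [Fintype ι]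
  [DecidableEq ι] (Q : CSSCode MX MZ ι) {p : ℕ}
  {q u c : (ι × Fin (p + 1)) ⊕ (MX × Fin p) → ZMod 2}

theorem mem_kerCode_starBalance_hX : q ∈ kerCode (Q.starBalance p).hX ↔
    (∀ e, Q.hX *ᵥ vertexBlock e.castSucc q = edgeBlock e q) ∧ vertexSum q ∈ kerCode Q.hX := by
  have hblocks : q ∈ kerCode (Q.starBalance p).hX ↔
      ∀ v, (fun i => ((Q.starBalance p).hX *ᵥ q) (i, v)) = 0 := by
    simp only [mem_kerCode, funext_iff, Prod.forall, Pi.zero_apply]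
    exact forall_comm
  rw [hblocks, Fin.forall_fin_succ', starBalance_hX_mulVec_last]
  simp only [starBalance_hX_mulVec_castSucc, add_eq_zero_iff_eq_neg (b := edgeBlock _ q),
    ZModModule.neg_eq_self]
  refine and_congr_right fun hedge => ?_
  rw [mem_kerCode, vertexSum_eq_sum, Fin.sum_univ_castSucc, Matrix.mulVec_add, add_comm,
    Matrix.mulVec_sum, Finset.sum_congr rfl fun e _ => hedge e]

theorem mem_kerCode_starBalance_hZ : q ∈ kerCode (Q.starBalance p).hZ ↔
    (∀ e, vertexBlock e.castSucc q = vertexBlock (Fin.last p) q + edgeBlock e q ᵥ* Q.hX) ∧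
      vertexBlock (Fin.last p) q ∈ kerCode Q.hZ := by
  have hblocks : q ∈ kerCode (Q.starBalance p).hZ ↔
      (∀ e, (fun a => ((Q.starBalance p).hZ *ᵥ q) (.inl (a, e))) = 0) ∧
        ∀ v, (fun j => ((Q.starBalance p).hZ *ᵥ q) (.inr (j, v))) = 0 := by
    simp only [mem_kerCode, funext_iff, Sum.forall, Prod.forall, Pi.zero_apply]
    exact and_congr forall_comm forall_comm
  rw [hblocks, Fin.forall_fin_succ']
  simp only [starBalance_hZ_mulVec_inl, starBalance_hZ_mulVec_inr, add_assoc,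
    add_eq_zero_iff_eq_neg (a := vertexBlock _ q), ZModModule.neg_eq_self]
  refine and_congr_right fun hedge => and_iff_right_of_imp fun hlast e => ?_
  rw [hedge, Matrix.mulVec_add, hlast, hZ_mulVec_vecMul_hX, add_zero]

variable {Q}

theorem vertexSum_mem_kerCode (hu : u ∈ kerCode (Q.starBalance p).hX) :
    vertexSum u ∈ kerCode Q.hX :=
  (Q.mem_kerCode_starBalance_hX.mp hu).2

theorem vertexBlock_last_mem_kerCode (hc : c ∈ kerCode (Q.starBalance p).hZ) :
    vertexBlock (Fin.last p) c ∈ kerCode Q.hZ :=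
  (Q.mem_kerCode_starBalance_hZ.mp hc).2

theorem dotProduct_eq_vertexSum_dotProduct (hu : u ∈ kerCode (Q.starBalance p).hX)
    (hc : c ∈ kerCode (Q.starBalance p).hZ) :
    u ⬝ᵥ c = vertexSum u ⬝ᵥ vertexBlock (Fin.last p) c := by
  obtain ⟨hu, -⟩ := Q.mem_kerCode_starBalance_hX.mp hu
  obtain ⟨hc, -⟩ := Q.mem_kerCode_starBalance_hZ.mp hc
  have hedge (e : Fin p) : vertexBlock e.castSucc u ⬝ᵥ vertexBlock e.castSucc c =
      vertexBlock e.castSucc u ⬝ᵥ vertexBlock (Fin.last p) c + edgeBlock e u ⬝ᵥ edgeBlock e c := by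
    rw [hc, dotProduct_add, ← hu, dotProduct_comm _ (edgeBlock e c ᵥ* _), dotProduct_comm (_ *ᵥ _),
      Matrix.dotProduct_mulVec]
  rw [dotProduct_eq_sum_blocks, Fin.sum_univ_castSucc, Finset.sum_congr rfl fun e _ => hedge e,
    Finset.sum_add_distrib, add_right_comm, add_assoc, add_assoc, CharTwo.add_cancel_left,
    vertexSum_eq_sum, sum_dotProduct, Fin.sum_univ_castSucc]

variable (Q p) in
theorem exists_vertexSum_eq (x : ι → ZMod 2) (hx : x ∈ kerCode Q.hX) :
    ∃ u ∈ kerCode (Q.starBalance p).hX, vertexSum u = x ∧ hammingNorm u = hammingNorm x := by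
  have hsum : vertexSum (ofBlocks (Pi.single (Fin.last p) x) (0 : Fin p → MX → ZMod 2)) = x := by
    simp [vertexSum_eq_sum, vertexBlock_ofBlocks]
  refine ⟨_, Q.mem_kerCode_starBalance_hX.mpr ⟨fun e => ?_, hsum.symm ▸ hx⟩, hsum, ?_⟩
  · simp [vertexBlock_ofBlocks, edgeBlock_ofBlocks, Fin.castSucc_ne_last]
  · simp [hammingNorm_eq_sum_blocks, vertexBlock_ofBlocks, edgeBlock_ofBlocks,
      Fin.sum_univ_castSucc, Fin.castSucc_ne_last]

variable (Q p) in
theorem exists_vertexBlock_last_eq (x : ι → ZMod 2) (hx : x ∈ kerCode Q.hZ) :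
    ∃ c ∈ kerCode (Q.starBalance p).hZ,
      vertexBlock (Fin.last p) c = x ∧ hammingNorm c = (p + 1) * hammingNorm x := by
  refine ⟨ofBlocks (fun _ => x) 0, Q.mem_kerCode_starBalance_hZ.mpr ⟨fun e => ?_, hx⟩, rfl, ?_⟩
  · simp [vertexBlock_ofBlocks, edgeBlock_ofBlocks]
  · simp [hammingNorm_eq_sum_blocks, vertexBlock_ofBlocks, edgeBlock_ofBlocks]

theorem mem_dualCode_kerCode_starBalance_hX (hc : c ∈ kerCode (Q.starBalance p).hZ) :
    c ∈ dualCode (kerCode (Q.starBalance p).hX) ↔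
      vertexBlock (Fin.last p) c ∈ dualCode (kerCode Q.hX) := by
  constructor
  · intro h x hx
    obtain ⟨u, hu, rfl, -⟩ := Q.exists_vertexSum_eq p x hx
    rw [dotProduct_comm, ← dotProduct_eq_vertexSum_dotProduct hu hc, dotProduct_comm, h u hu]
  · intro h u hu
    rw [dotProduct_comm, dotProduct_eq_vertexSum_dotProduct hu hc, dotProduct_comm,
      h _ (vertexSum_mem_kerCode hu)]

theorem mem_dualCode_kerCode_starBalance_hZ (hu : u ∈ kerCode (Q.starBalance p).hX) :
    u ∈ dualCode (kerCode (Q.starBalance p).hZ) ↔ vertexSum u ∈ dualCode (kerCode Q.hZ) := by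
  constructor
  · intro h x hx
    obtain ⟨c, hc, rfl, -⟩ := Q.exists_vertexBlock_last_eq p x hx
    rw [← dotProduct_eq_vertexSum_dotProduct hu hc, h c hc]
  · intro h c hc
    rw [dotProduct_eq_vertexSum_dotProduct hu hc, h _ (vertexBlock_last_mem_kerCode hc)]

variable (Q p) in
theorem finrank_logicalClasses_starBalance :
    Module.finrank (ZMod 2) (Q.starBalance p).logicalClasses =
      Module.finrank (ZMod 2) Q.logicalClasses := by
  refine finrank_quotient_eq_of_comap_eq
    (f := (vertexBlock (Fin.last p)).restrict fun _ => vertexBlock_last_mem_kerCode) ?_ ?_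
  · rintro ⟨x, hx⟩
    obtain ⟨c, hc, hcx, -⟩ := Q.exists_vertexBlock_last_eq p x hx
    exact ⟨⟨c, hc⟩, Subtype.ext hcx⟩
  · ext c
    exact (mem_dualCode_kerCode_starBalance_hX c.2).symm

theorem isLeast_nontrivialWeights_starBalance_X {d : ℕ}
    (h : IsLeast (nontrivialWeights (kerCode Q.hX) (kerCode Q.hZ)) d) :
    IsLeast (nontrivialWeights (kerCode (Q.starBalance p).hX)
      (kerCode (Q.starBalance p).hZ)) d := by
  rw [isLeast_nontrivialWeights_iff] at h ⊢
  obtain ⟨⟨x, hx, hxd, rfl⟩, hmin⟩ := h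
  constructor
  · obtain ⟨u, hu, rfl, hnorm⟩ := Q.exists_vertexSum_eq p x hx
    exact ⟨u, hu, mt (mem_dualCode_kerCode_starBalance_hZ hu).mp hxd, hnorm⟩
  · exact fun u hu hud => (hmin _ (vertexSum_mem_kerCode hu) <|
      mt (mem_dualCode_kerCode_starBalance_hZ hu).mpr hud).trans (hammingNorm_vertexSum_le u)

theorem le_hammingNorm_vertexBlock {d : ℕ}
    (h : IsLeast (nontrivialWeights (kerCode Q.hZ) (kerCode Q.hX)) d)
    (hc : c ∈ kerCode (Q.starBalance p).hZ) (hcd : c ∉ dualCode (kerCode (Q.starBalance p).hX))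
    (v : Fin (p + 1)) : d ≤ hammingNorm (vertexBlock v c) := by
  have hmin := (isLeast_nontrivialWeights_iff.mp h).2
  obtain ⟨hedge, hlast⟩ := Q.mem_kerCode_starBalance_hZ.mp hc
  rw [mem_dualCode_kerCode_starBalance_hX hc] at hcd
  refine v.lastCases (hmin _ hlast hcd) fun e => ?_
  have hy := Q.vecMul_hX_mem_dualCode (edgeBlock e c)
  rw [hedge]
  exact hmin _ (add_mem hlast (Q.dualCode_kerCode_hX_le hy))
    (mt (Submodule.add_mem_iff_left _ hy).mp hcd)

theorem isLeast_nontrivialWeights_starBalance_Z {d : ℕ}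
    (h : IsLeast (nontrivialWeights (kerCode Q.hZ) (kerCode Q.hX)) d) :
    IsLeast (nontrivialWeights (kerCode (Q.starBalance p).hZ)
      (kerCode (Q.starBalance p).hX)) ((p + 1) * d) := by
  obtain ⟨x, hx, hxd, rfl⟩ := h.1
  refine isLeast_nontrivialWeights_iff.mpr ⟨?_, fun c hc hcd => ?_⟩
  · obtain ⟨c, hc, rfl, hnorm⟩ := Q.exists_vertexBlock_last_eq p x hx
    exact ⟨c, hc, mt (mem_dualCode_kerCode_starBalance_hX hc).mp hxd, hnorm⟩
  · calc (p + 1) * hammingNorm x = ∑ _v : Fin (p + 1), hammingNorm x := by simp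
      _ ≤ ∑ v, hammingNorm (vertexBlock v c) :=
        Finset.sum_le_sum fun v _ => le_hammingNorm_vertexBlock h hc hcd v
      _ ≤ hammingNorm c := hammingNorm_eq_sum_blocks c ▸ Nat.le_add_right _ _

end CSSCode

/-! ### Local testability of a star-balanced code -/

namespace CSSCode

section Soundness

variable {MX MZ ι : Type*} [Fintype MX] [DecidableEq MX] [DecidableEq MZ] [Fintype ι]
  [DecidableEq ι] (Q : CSSCode MX MZ ι) {p : ℕ}
  (q : (ι × Fin (p + 1)) ⊕ (MX × Fin p) → ZMod 2)

theorem hX_mulVec_vertexSum :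
    Q.hX *ᵥ vertexSum q = ∑ v, fun i => ((Q.starBalance p).hX *ᵥ q) (i, v) := by
  simp only [Fin.sum_univ_castSucc, starBalance_hX_mulVec_castSucc, starBalance_hX_mulVec_last,
    vertexSum_eq_sum, Matrix.mulVec_add, Matrix.mulVec_sum, Finset.sum_add_distrib]
  rw [add_add_add_comm, ZModModule.add_self, add_zero]

theorem hammingNorm_hX_mulVec_vertexSum_le :
    hammingNorm (Q.hX *ᵥ vertexSum q) ≤ hammingNorm ((Q.starBalance p).hX *ᵥ q) := by
  rw [hX_mulVec_vertexSum, hammingNorm_prod_type]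
  exact hammingNorm_finset_sum_le _ _

theorem distTo_kerCode_starBalance_hX_le :
    distTo q (kerCode (Q.starBalance p).hX) ≤
      hammingNorm ((Q.starBalance p).hX *ᵥ q) + distTo (vertexSum q) (kerCode Q.hX) := by
  obtain ⟨z, hz, hznorm⟩ := exists_add_mem_hammingNorm_eq_distTo (vertexSum q) (kerCode Q.hX)
  let s (v : Fin (p + 1)) (i : MX) : ZMod 2 := ((Q.starBalance p).hX *ᵥ q) (i, v)
  have hs (e : Fin p) : s e.castSucc = Q.hX *ᵥ vertexBlock e.castSucc q + edgeBlock e q :=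
    Q.starBalance_hX_mulVec_castSucc q e
  let r := ofBlocks (Pi.single (Fin.last p) z) fun e => s e.castSucc
  have hmem : q + r ∈ kerCode (Q.starBalance p).hX := by
    refine Q.mem_kerCode_starBalance_hX.mpr ⟨fun e => ?_, ?_⟩
    · simp [r, vertexBlock_ofBlocks, edgeBlock_ofBlocks, Fin.castSucc_ne_last, hs,
        add_left_comm (edgeBlock e q), ZModModule.add_self]
    · simpa [r, vertexSum_eq_sum, vertexBlock_ofBlocks, Finset.sum_add_distrib] using hz
  calc distTo q (kerCode (Q.starBalance p).hX)
      ≤ hammingNorm r := distTo_le_of_add_mem hmem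
    _ = ∑ e : Fin p, hammingNorm (s e.castSucc) + hammingNorm z := by
        simp [r, hammingNorm_eq_sum_blocks, vertexBlock_ofBlocks, edgeBlock_ofBlocks,
          Fin.sum_univ_castSucc, Fin.castSucc_ne_last, add_comm]
    _ ≤ ∑ v, hammingNorm (s v) + hammingNorm z := by
        rw [Fin.sum_univ_castSucc]
        gcongr
        exact Nat.le_add_right _ _
    _ = _ := by rw [hammingNorm_prod_type, hznorm]

theorem isLTC_starBalance_hX {ρ : ℝ} {w w' : ℕ} (hp : 0 < p) (hρ : 0 ≤ ρ) (h : IsLTC Q.hX ρ w)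
    (hw' : ∀ i, rowWeight (Q.starBalance p).hX i ≤ w') :
    IsLTC (Q.starBalance p).hX (min ρ 1 / 2) w' := by
  refine isLTC_iff.mpr ⟨hw', fun q => ?_⟩
  set D := (distTo (vertexSum q) (kerCode Q.hX) : ℝ)
  set S := (hammingNorm ((Q.starBalance p).hX *ᵥ q) : ℝ)
  have hdist : (distTo q (kerCode (Q.starBalance p).hX) : ℝ) ≤ S + D :=
    (Nat.cast_le.mpr (Q.distTo_kerCode_starBalance_hX_le q)).trans_eq (Nat.cast_add _ _)
  have hD : min ρ 1 * Fintype.card MX * D ≤ Fintype.card ι * S := calc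
    min ρ 1 * Fintype.card MX * D ≤ ρ * Fintype.card MX * D := by
        gcongr
        exact min_le_left _ _
    _ ≤ Fintype.card ι * hammingNorm (Q.hX *ᵥ vertexSum q) := (isLTC_iff.mp h).2 _
    _ ≤ Fintype.card ι * S := by
        gcongr
        exact Nat.cast_le.mpr (Q.hammingNorm_hX_mulVec_vertexSum_le q)
  have hS : min ρ 1 * S ≤ S := mul_le_of_le_one_left (Nat.cast_nonneg _) (min_le_right _ _)
  have hp' : (p + 1 : ℝ) ≤ 2 * p := by
    have : (1 : ℝ) ≤ p := mod_cast hp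
    linarith
  have : 0 ≤ min ρ 1 := le_min hρ zero_le_one
  simp only [Fintype.card_sum, Fintype.card_prod, Fintype.card_fin]
  push_cast
  calc min ρ 1 / 2 * (Fintype.card MX * (p + 1)) * distTo q (kerCode (Q.starBalance p).hX)
      ≤ min ρ 1 / 2 * (Fintype.card MX * (p + 1)) * (S + D) := by gcongr
    _ = (p + 1) / 2 * Fintype.card MX * (min ρ 1 * S) +
          (p + 1) / 2 * (min ρ 1 * Fintype.card MX * D) := by ring
    _ ≤ 2 * p / 2 * Fintype.card MX * S + (p + 1) * (Fintype.card ι * S) := by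
        gcongr
        exact half_le_self (by positivity)
    _ = (Fintype.card ι * (p + 1) + Fintype.card MX * p) * S := by ring

variable [Fintype MZ]

theorem hammingNorm_hZ_mulVec_vertexBlock_last_le {b : ℕ} (hb : ∀ a, colWeight Q.hZ a ≤ b)
    (e : Fin p) :
    hammingNorm (Q.hZ *ᵥ vertexBlock (Fin.last p) q) ≤
      b * hammingNorm (fun a => ((Q.starBalance p).hZ *ᵥ q) (.inl (a, e))) +
        hammingNorm (Q.hZ *ᵥ vertexBlock e.castSucc q) := by
  have hlast : Q.hZ *ᵥ vertexBlock (Fin.last p) q =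
      Q.hZ *ᵥ (fun a => ((Q.starBalance p).hZ *ᵥ q) (.inl (a, e))) +
        Q.hZ *ᵥ vertexBlock e.castSucc q := by
    rw [starBalance_hZ_mulVec_inl, Matrix.mulVec_add, hZ_mulVec_vecMul_hX, add_zero,
      Matrix.mulVec_add, add_right_comm, ZModModule.add_self, zero_add]
  rw [hlast]
  exact (hammingNorm_add_le _ _).trans (by gcongr; exact hammingNorm_mulVec_le hb _)

theorem distTo_kerCode_starBalance_hZ_le {b κ : ℕ} (hb : ∀ a, colWeight Q.hZ a ≤ b)
    (hκ : ∀ x, distTo x (kerCode Q.hZ) ≤ κ * hammingNorm (Q.hZ *ᵥ x)) :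
    distTo q (kerCode (Q.starBalance p).hZ) ≤
      (κ * b + 1) * hammingNorm (fun s => ((Q.starBalance p).hZ *ᵥ q) (.inl s)) +
        κ * hammingNorm (fun s => ((Q.starBalance p).hZ *ᵥ q) (.inr s)) := by
  obtain ⟨z, hz, hznorm⟩ :=
    exists_add_mem_hammingNorm_eq_distTo (vertexBlock (Fin.last p) q) (kerCode Q.hZ)
  let s (e : Fin p) (a : ι) : ZMod 2 := ((Q.starBalance p).hZ *ᵥ q) (.inl (a, e))
  let t (v : Fin (p + 1)) : MZ → ZMod 2 := Q.hZ *ᵥ vertexBlock v q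
  have hs (e : Fin p) : s e = vertexBlock e.castSucc q + vertexBlock (Fin.last p) q +
      edgeBlock e q ᵥ* Q.hX := Q.starBalance_hZ_mulVec_inl q e
  let r : (ι × Fin (p + 1)) ⊕ (MX × Fin p) → ZMod 2 :=
    ofBlocks (Fin.snoc (fun e => s e + z) z) 0
  have hmem : q + r ∈ kerCode (Q.starBalance p).hZ := by
    refine Q.mem_kerCode_starBalance_hZ.mpr ⟨fun e => ?_, ?_⟩
    · simp only [r, map_add, vertexBlock_ofBlocks, edgeBlock_ofBlocks, Fin.snoc_castSucc,
        Fin.snoc_last, hs, Pi.zero_apply, add_zero, ← add_assoc, ZModModule.add_self, zero_add]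
      exact add_right_comm _ _ _
    · simpa only [r, map_add, vertexBlock_ofBlocks, Fin.snoc_last] using hz
  have hzt (e : Fin p) : hammingNorm z ≤
      κ * (b * hammingNorm (s e) + hammingNorm (t e.castSucc)) :=
    hznorm.trans_le <| (hκ _).trans <|
      Nat.mul_le_mul_left κ (Q.hammingNorm_hZ_mulVec_vertexBlock_last_le q hb e)
  calc distTo q (kerCode (Q.starBalance p).hZ)
      ≤ hammingNorm r := distTo_le_of_add_mem hmem
    _ = ∑ e, hammingNorm (s e + z) + hammingNorm z := by
        simp [r, hammingNorm_eq_sum_blocks, vertexBlock_ofBlocks, edgeBlock_ofBlocks,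
          Fin.sum_univ_castSucc]
    _ ≤ ∑ e, (hammingNorm (s e) + κ * (b * hammingNorm (s e) + hammingNorm (t e.castSucc))) +
          κ * hammingNorm (t (Fin.last p)) := by
        gcongr with e
        · exact (hammingNorm_add_le _ _).trans (by gcongr; exact hzt e)
        · exact hznorm.trans_le (hκ _)
    _ = (κ * b + 1) * ∑ e, hammingNorm (s e) + κ * ∑ v, hammingNorm (t v) := by
        simp only [Fin.sum_univ_castSucc, Finset.sum_add_distrib, ← Finset.mul_sum]
        ring
    _ = _ := by
        rw [hammingNorm_prod_type, hammingNorm_prod_type]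
        simp only [starBalance_hZ_mulVec_inr, s, t]

end Soundness

section Weights

variable {MX MZ ι : Type*} [Fintype MX] [DecidableEq MX] [DecidableEq MZ] [Fintype ι]
  [DecidableEq ι] (Q : CSSCode MX MZ ι) {p : ℕ}

theorem rowWeight_starBalance_hX (s : MX × Fin (p + 1)) :
    rowWeight (Q.starBalance p).hX s = rowWeight Q.hX s.1 + rowWeight (starIncidence p) s.2 := by
  simp only [starBalance, distanceBalance, rowWeight_fromCols, rowWeight_kronecker, rowWeight_one,
    mul_one, one_mul]

theorem rowWeight_starBalance_hZ_inl (s : ι × Fin p) :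
    rowWeight (Q.starBalance p).hZ (.inl s) = 2 + colWeight Q.hX s.1 := by
  simp only [starBalance, distanceBalance, rowWeight_fromBlocks_inl, rowWeight_kronecker,
    rowWeight_one, rowWeight_transpose, colWeight_starIncidence, mul_one, one_mul]

theorem rowWeight_starBalance_hZ_inr (s : MZ × Fin (p + 1)) :
    rowWeight (Q.starBalance p).hZ (.inr s) = rowWeight Q.hZ s.1 := by
  simp only [starBalance, distanceBalance, rowWeight_fromBlocks_inr, rowWeight_kronecker,
    rowWeight_one, rowWeight_zero, mul_one, add_zero]

theorem colWeight_starBalance_hX_inl (a : ι × Fin (p + 1)) :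
    colWeight (Q.starBalance p).hX (.inl a) = colWeight Q.hX a.1 := by
  simp only [starBalance, distanceBalance, colWeight_fromCols_inl, colWeight_kronecker,
    colWeight_one, mul_one]

theorem colWeight_starBalance_hX_inr (s : MX × Fin p) :
    colWeight (Q.starBalance p).hX (.inr s) = 2 := by
  simp only [starBalance, distanceBalance, colWeight_fromCols_inr, colWeight_kronecker,
    colWeight_one, colWeight_starIncidence, one_mul]

theorem colWeight_starBalance_hZ_inl [Fintype MZ] (a : ι × Fin (p + 1)) :
    colWeight (Q.starBalance p).hZ (.inl a) =
      rowWeight (starIncidence p) a.2 + colWeight Q.hZ a.1 := by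
  simp only [starBalance, distanceBalance, colWeight_fromBlocks_inl, colWeight_kronecker,
    colWeight_one, colWeight_transpose, mul_one, one_mul]

theorem colWeight_starBalance_hZ_inr [Fintype MZ] (s : MX × Fin p) :
    colWeight (Q.starBalance p).hZ (.inr s) = rowWeight Q.hX s.1 := by
  simp only [starBalance, distanceBalance, colWeight_fromBlocks_inr, colWeight_kronecker,
    colWeight_one, colWeight_zero, colWeight_transpose, mul_one, add_zero]

variable {Q} {K : ℕ}

theorem rowWeight_starBalance_hX_castSucc_le (hK : ∀ i, rowWeight Q.hX i + 1 ≤ K) (i : MX)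
    (e : Fin p) : rowWeight (Q.starBalance p).hX (i, e.castSucc) ≤ K := by
  rw [rowWeight_starBalance_hX, rowWeight_starIncidence_castSucc]
  exact hK i

theorem rowWeight_starBalance_hX_last_le (hK : ∀ i, rowWeight Q.hX i + 1 ≤ K) (i : MX) :
    rowWeight (Q.starBalance p).hX (i, Fin.last p) ≤ K * (p + 1) := by
  rw [rowWeight_starBalance_hX, rowWeight_starIncidence_last]
  nlinarith [hK i]

theorem rowWeight_starBalance_hX_le (hK : ∀ i, rowWeight Q.hX i + 1 ≤ K) (s : MX × Fin (p + 1)) :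
    rowWeight (Q.starBalance p).hX s ≤ K * (p + 1) :=
  s.2.lastCases (motive := fun v => rowWeight (Q.starBalance p).hX (s.1, v) ≤ K * (p + 1))
    (rowWeight_starBalance_hX_last_le hK s.1) fun e =>
      (rowWeight_starBalance_hX_castSucc_le hK s.1 e).trans (Nat.le_mul_of_pos_right K p.succ_pos)

theorem rowWeight_starBalance_hZ_le (hX : ∀ a, 2 + colWeight Q.hX a ≤ K)
    (hZ : ∀ j, rowWeight Q.hZ j ≤ K) : ∀ s, rowWeight (Q.starBalance p).hZ s ≤ K
  | .inl s => (Q.rowWeight_starBalance_hZ_inl s).trans_le (hX s.1)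
  | .inr s => (Q.rowWeight_starBalance_hZ_inr s).trans_le (hZ s.1)

theorem colWeight_starBalance_hX_le (hK : 2 ≤ K) (hX : ∀ a, colWeight Q.hX a ≤ K) :
    ∀ s, colWeight (Q.starBalance p).hX s ≤ K
  | .inl a => (Q.colWeight_starBalance_hX_inl a).trans_le (hX a.1)
  | .inr s => (Q.colWeight_starBalance_hX_inr s).trans_le hK

theorem exists_heavy_rows_starBalance_hX (hp : 0 < p) (hK : ∀ i, rowWeight Q.hX i + 2 ≤ K) :
    ∃ S : Finset (MX × Fin (p + 1)), (p + 1) * S.card = Fintype.card (MX × Fin (p + 1)) ∧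
      (∀ i ∈ S, p + 1 ≤ K * rowWeight (Q.starBalance p).hX i ∧
        rowWeight (Q.starBalance p).hX i ≤ K * (p + 1)) ∧
      ∀ i ∉ S, rowWeight (Q.starBalance p).hX i ≤ K := by
  have hK' (i : MX) : rowWeight Q.hX i + 1 ≤ K := by linarith [hK i]
  refine ⟨Finset.univ ×ˢ {Fin.last p}, by simp [mul_comm], ?_, ?_⟩
  · rintro ⟨i, v⟩ hv
    obtain rfl : Fin.last p = v := by simpa using hv
    refine ⟨?_, rowWeight_starBalance_hX_last_le hK' i⟩
    rw [rowWeight_starBalance_hX, rowWeight_starIncidence_last]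
    nlinarith [hK i]
  · rintro ⟨i, v⟩ hv
    obtain ⟨e, rfl⟩ : ∃ e : Fin p, e.castSucc = v :=
      Fin.exists_castSucc_eq.mpr fun h => hv (by simp [h])
    exact rowWeight_starBalance_hX_castSucc_le hK' i e

theorem exists_heavy_cols_starBalance_hZ [Fintype MZ] (hX : ∀ i, rowWeight Q.hX i ≤ K)
    (hZ : ∀ a, colWeight Q.hZ a + 1 ≤ K) (hZ₀ : ∀ a, 0 < colWeight Q.hZ a) :
    ∃ T : Finset ((ι × Fin (p + 1)) ⊕ (MX × Fin p)),
      (p + 1) * T.card ≤ Fintype.card ((ι × Fin (p + 1)) ⊕ (MX × Fin p)) ∧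
      (∀ q ∈ T, p + 1 ≤ K * colWeight (Q.starBalance p).hZ q ∧
        colWeight (Q.starBalance p).hZ q ≤ K * (p + 1)) ∧
      ∀ q ∉ T, colWeight (Q.starBalance p).hZ q ≤ K := by
  refine ⟨(Finset.univ ×ˢ {Fin.last p}).disjSum ∅, ?_, ?_, ?_⟩
  · simp [mul_comm]
  · rintro (⟨a, v⟩ | s) hq
    · obtain rfl : Fin.last p = v := by simpa using hq
      rw [colWeight_starBalance_hZ_inl, rowWeight_starIncidence_last]
      constructor <;> nlinarith [hZ a, hZ₀ a]
    · simp at hq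
  · rintro (⟨a, v⟩ | s) hq
    · obtain ⟨e, rfl⟩ : ∃ e : Fin p, e.castSucc = v :=
        Fin.exists_castSucc_eq.mpr fun h => hq (by simp [h])
      rw [colWeight_starBalance_hZ_inl, rowWeight_starIncidence_castSucc, add_comm]
      exact hZ a
    · rw [colWeight_starBalance_hZ_inr]
      exact hX s.1

end Weights

end CSSCode

/-! ### The gauge-fixed code -/

section HalfSum

variable {ι : Type*}

/-- The sum of the two halves of a word. The checks `[I, I]` compute it, and the checks `[H, H]`
are those of `H` on it. -/
def halfSum : (ι ⊕ ι → ZMod 2) →ₗ[ZMod 2] (ι → ZMod 2) :=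
  LinearMap.funLeft _ _ Sum.inl + LinearMap.funLeft _ _ Sum.inr

theorem halfSum_elim (a b : ι → ZMod 2) : halfSum (Sum.elim a b) = a + b :=
  rfl

theorem halfSum_eq_zero_iff {x : ι ⊕ ι → ZMod 2} :
    halfSum x = 0 ↔ ∃ a, x = Sum.elim a a := by
  constructor
  · refine fun h => ⟨x ∘ Sum.inl, ?_⟩
    have hx : x ∘ Sum.inl = x ∘ Sum.inr := by
      rw [← ZModModule.neg_eq_self (x ∘ Sum.inr)]
      exact eq_neg_of_add_eq_zero_left h
    rw [← Sum.elim_comp_inl_inr x, ← hx, Sum.elim_comp_inl]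
  · rintro ⟨a, rfl⟩
    rw [halfSum_elim, ZModModule.add_self]

variable [Fintype ι]

theorem hammingNorm_sum_elim (a b : ι → ZMod 2) :
    hammingNorm (Sum.elim a b) = hammingNorm a + hammingNorm b :=
  hammingNorm_sum_type _

theorem hammingNorm_halfSum_le (x : ι ⊕ ι → ZMod 2) : hammingNorm (halfSum x) ≤ hammingNorm x := by
  rw [hammingNorm_sum_type x]
  exact hammingNorm_add_le _ _

theorem dotProduct_elim_self (x : ι ⊕ ι → ZMod 2) (a : ι → ZMod 2) :
    x ⬝ᵥ Sum.elim a a = halfSum x ⬝ᵥ a := by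
  rw [← Sum.elim_comp_inl_inr x, sumElim_dotProduct_sumElim, halfSum_elim, add_dotProduct]

end HalfSum

section GaugeFixed

variable {M ι : Type*} [Fintype ι] [DecidableEq ι] (H : Matrix M ι (ZMod 2)) {x : ι ⊕ ι → ZMod 2}

theorem gaugeFixed_hX_mulVec (x : ι ⊕ ι → ZMod 2) :
    (gaugeFixed H).hX *ᵥ x = H *ᵥ halfSum x := by
  rw [gaugeFixed, Matrix.fromCols_mulVec, ← Matrix.mulVec_add]
  rfl

theorem gaugeFixed_hZ_mulVec (x : ι ⊕ ι → ZMod 2) : (gaugeFixed H).hZ *ᵥ x = halfSum x := by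
  rw [gaugeFixed, Matrix.fromCols_mulVec, Matrix.one_mulVec, Matrix.one_mulVec]
  rfl

theorem mem_kerCode_gaugeFixed_hX :
    x ∈ kerCode (gaugeFixed H).hX ↔ halfSum x ∈ kerCode H := by
  rw [mem_kerCode, gaugeFixed_hX_mulVec, mem_kerCode]

theorem mem_kerCode_gaugeFixed_hZ :
    x ∈ kerCode (gaugeFixed H).hZ ↔ ∃ a, x = Sum.elim a a := by
  rw [mem_kerCode, gaugeFixed_hZ_mulVec, halfSum_eq_zero_iff]

theorem mem_dualCode_kerCode_gaugeFixed_hZ :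
    x ∈ dualCode (kerCode (gaugeFixed H).hZ) ↔ halfSum x = 0 := by
  simp only [mem_dualCode, mem_kerCode_gaugeFixed_hZ]
  constructor
  · exact fun h => dotProduct_eq_zero _ fun a => dotProduct_elim_self x a ▸ h _ ⟨a, rfl⟩
  · rintro hx _ ⟨a, rfl⟩
    rw [dotProduct_elim_self, hx, zero_dotProduct]

theorem elim_self_mem_dualCode_kerCode_gaugeFixed_hX {a : ι → ZMod 2} :
    Sum.elim a a ∈ dualCode (kerCode (gaugeFixed H).hX) ↔ a ∈ dualCode (kerCode H) := by
  simp only [mem_dualCode, mem_kerCode_gaugeFixed_hX, dotProduct_comm (Sum.elim a a),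
    dotProduct_elim_self, dotProduct_comm a]
  refine ⟨fun h c hc => ?_, fun h x hx => h _ hx⟩
  simpa [halfSum_elim] using h (Sum.elim c 0) (by simpa [halfSum_elim] using hc)

variable {H}

theorem isLeast_nontrivialWeights_gaugeFixed_X {d : ℕ}
    (h : IsLeast {t | ∃ c ∈ kerCode H, c ≠ 0 ∧ hammingNorm c = t} d) :
    IsLeast (nontrivialWeights (kerCode (gaugeFixed H).hX) (kerCode (gaugeFixed H).hZ)) d := by
  simp only [isLeast_nontrivialWeights_iff, mem_kerCode_gaugeFixed_hX,
    mem_dualCode_kerCode_gaugeFixed_hZ]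
  obtain ⟨c, hc, hc0, rfl⟩ := h.1
  refine ⟨⟨Sum.elim c 0, ?_, ?_, ?_⟩, fun x hx hx0 => ?_⟩
  · rwa [halfSum_elim, add_zero]
  · rwa [halfSum_elim, add_zero]
  · rw [hammingNorm_sum_elim, hammingNorm_zero, add_zero]
  · exact (h.2 ⟨_, hx, hx0, rfl⟩).trans (hammingNorm_halfSum_le x)

theorem isLeast_nontrivialWeights_gaugeFixed_Z (hC : kerCode H ≠ ⊥) :
    IsLeast (nontrivialWeights (kerCode (gaugeFixed H).hZ) (kerCode (gaugeFixed H).hX)) 2 := by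
  rw [isLeast_nontrivialWeights_iff]
  constructor
  · obtain ⟨c, hc, hc0⟩ := Submodule.exists_mem_ne_zero_of_ne_bot hC
    obtain ⟨j, hj⟩ := Function.ne_iff.mp hc0
    refine ⟨Sum.elim (Pi.single j 1) (Pi.single j 1), (mem_kerCode_gaugeFixed_hZ H).mpr ⟨_, rfl⟩,
      fun hdual => hj ?_, by rw [hammingNorm_sum_elim, hammingNorm_single_one]⟩
    rw [elim_self_mem_dualCode_kerCode_gaugeFixed_hX] at hdual
    simpa using hdual c hc
  · intro x hx hxd
    obtain ⟨a, rfl⟩ := (mem_kerCode_gaugeFixed_hZ H).mp hx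
    have ha : 0 < hammingNorm a := hammingNorm_pos_iff.mpr <| by
      rintro rfl
      exact hxd ((elim_self_mem_dualCode_kerCode_gaugeFixed_hX H).mpr (zero_mem _))
    rw [hammingNorm_sum_elim]
    omega

theorem finrank_logicalClasses_gaugeFixed [Finite M] (H : Matrix M ι (ZMod 2)) :
    Module.finrank (ZMod 2) (gaugeFixed H).logicalClasses =
      Module.finrank (ZMod 2) (kerCode H) := by
  rw [← finrank_quotient_dualCode_kerCode]
  refine finrank_quotient_eq_of_comap_eq
    (f := LinearMap.funLeft _ _ Sum.inl ∘ₗ (kerCode (gaugeFixed H).hZ).subtype) (fun a => ?_) ?_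
  · exact ⟨⟨Sum.elim a a, (mem_kerCode_gaugeFixed_hZ H).mpr ⟨a, rfl⟩⟩, rfl⟩
  · ext ⟨x, hx⟩
    obtain ⟨a, rfl⟩ := (mem_kerCode_gaugeFixed_hZ H).mp hx
    exact (elim_self_mem_dualCode_kerCode_gaugeFixed_hX H).symm

theorem distTo_kerCode_gaugeFixed_hX_le (x : ι ⊕ ι → ZMod 2) :
    distTo x (kerCode (gaugeFixed H).hX) ≤ distTo (halfSum x) (kerCode H) := by
  obtain ⟨z, hz, hznorm⟩ := exists_add_mem_hammingNorm_eq_distTo (halfSum x) (kerCode H)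
  have hmem : x + Sum.elim z 0 ∈ kerCode (gaugeFixed H).hX := by
    rwa [mem_kerCode_gaugeFixed_hX, map_add, halfSum_elim, add_zero]
  refine (distTo_le_of_add_mem hmem).trans_eq ?_
  rw [hammingNorm_sum_elim, hammingNorm_zero, add_zero, hznorm]

theorem distTo_kerCode_gaugeFixed_hZ_le (x : ι ⊕ ι → ZMod 2) :
    distTo x (kerCode (gaugeFixed H).hZ) ≤ hammingNorm ((gaugeFixed H).hZ *ᵥ x) := by
  have hmem : x + Sum.elim (halfSum x) 0 ∈ kerCode (gaugeFixed H).hZ := by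
    rw [mem_kerCode, gaugeFixed_hZ_mulVec, map_add, halfSum_elim, add_zero, ZModModule.add_self]
  refine (distTo_le_of_add_mem hmem).trans_eq ?_
  rw [hammingNorm_sum_elim, hammingNorm_zero, add_zero, gaugeFixed_hZ_mulVec]

theorem rowWeight_gaugeFixed_hX (i : M) : rowWeight (gaugeFixed H).hX i = 2 * rowWeight H i := by
  rw [two_mul]
  exact rowWeight_fromCols H H i

theorem rowWeight_gaugeFixed_hZ (j : ι) : rowWeight (gaugeFixed H).hZ j = 2 := by
  rw [gaugeFixed, rowWeight_fromCols, rowWeight_one]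

theorem colWeight_gaugeFixed_hX [Fintype M] (a : ι ⊕ ι) :
    colWeight (gaugeFixed H).hX a = colWeight H (a.elim id id) := by
  cases a <;> rfl

theorem colWeight_gaugeFixed_hZ (a : ι ⊕ ι) : colWeight (gaugeFixed H).hZ a = 1 := by
  cases a <;> exact colWeight_one _

theorem isLTC_gaugeFixed_hX [Fintype M] {ρ : ℝ} {w : ℕ} (hρ : 0 ≤ ρ) (h : IsLTC H ρ w) :
    IsLTC (gaugeFixed H).hX (2 * ρ) (2 * w) := by
  refine isLTC_iff.mpr ⟨fun i => ?_, fun x => ?_⟩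
  · rw [rowWeight_gaugeFixed_hX]
    exact Nat.mul_le_mul_left 2 (h.1 i)
  · have hdist := distTo_kerCode_gaugeFixed_hX_le (H := H) x
    have hsound := (isLTC_iff.mp h).2 (halfSum x)
    rw [gaugeFixed_hX_mulVec, Fintype.card_sum, Nat.cast_add, ← two_mul]
    calc 2 * ρ * Fintype.card M * distTo x (kerCode (gaugeFixed H).hX)
        ≤ 2 * ρ * Fintype.card M * distTo (halfSum x) (kerCode H) := by gcongr
      _ = 2 * (ρ * Fintype.card M * distTo (halfSum x) (kerCode H)) := by ring
      _ ≤ 2 * (Fintype.card ι * hammingNorm (H *ᵥ halfSum x)) := by gcongr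
      _ = 2 * Fintype.card ι * hammingNorm (H *ᵥ halfSum x) := by ring

end GaugeFixed

/-! ### Locality bounds the soundness -/

section Locality

variable {M ι : Type*} [Fintype M] [Fintype ι] {H : Matrix M ι (ZMod 2)} {ρ : ℝ} {w : ℕ}

theorem sum_colWeight_eq_sum_rowWeight (H : Matrix M ι (ZMod 2)) :
    ∑ j, colWeight H j = ∑ i, rowWeight H i := by
  simp only [colWeight, rowWeight, hammingNorm_eq_sum]
  exact Finset.sum_comm

theorem card_le_mul_card_of_colWeight_pos (hw : ∀ i, rowWeight H i ≤ w)
    (hH : ∀ j, 0 < colWeight H j) : Fintype.card ι ≤ w * Fintype.card M := calc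
  Fintype.card ι = ∑ _j : ι, 1 := Finset.card_eq_sum_ones _
  _ ≤ ∑ j, colWeight H j := Finset.sum_le_sum fun j _ => hH j
  _ = ∑ i, rowWeight H i := sum_colWeight_eq_sum_rowWeight H
  _ ≤ ∑ _i : M, w := Finset.sum_le_sum fun i _ => hw i
  _ = w * Fintype.card M := by rw [Finset.sum_const, Finset.card_univ, smul_eq_mul, mul_comm]

theorem hammingNorm_mulVec_single_one [DecidableEq ι] (H : Matrix M ι (ZMod 2)) (j : ι) :
    hammingNorm (H *ᵥ Pi.single j 1) = colWeight H j := by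
  rw [Matrix.mulVec_single_one]
  rfl

theorem single_one_mem_kerCode_iff [DecidableEq ι] {j : ι} :
    Pi.single j 1 ∈ kerCode H ↔ colWeight H j = 0 := by
  rw [mem_kerCode, ← hammingNorm_eq_zero, hammingNorm_mulVec_single_one]

theorem colWeight_pos_of_two_le_hammingNorm
    (hd : ∀ c ∈ kerCode H, c ≠ 0 → 2 ≤ hammingNorm c) (j : ι) : 0 < colWeight H j := by
  classical
  by_contra! hj
  have hweight := hd _ (single_one_mem_kerCode_iff.mpr (Nat.le_zero.mp hj))
    (Pi.single_ne_zero_iff.mpr one_ne_zero)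
  rw [hammingNorm_single_one] at hweight
  exact absurd hweight (by decide)

theorem IsLTC.soundness_mul_card_le {b : ℕ} (h : IsLTC H ρ b) (hρ : 0 ≤ ρ) {j : ι}
    (hj : 0 < colWeight H j) :
    ρ * Fintype.card M ≤ Fintype.card ι * colWeight H j := by
  classical
  have hdist : 0 < distTo (Pi.single j 1) (kerCode H) := by
    obtain ⟨z, hz, hznorm⟩ :=
      exists_add_mem_hammingNorm_eq_distTo (Pi.single j (1 : ZMod 2)) (kerCode H)
    refine hznorm ▸ hammingNorm_pos_iff.mpr ?_
    rintro rfl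
    exact hj.ne' (single_one_mem_kerCode_iff.mp (by simpa using hz))
  calc ρ * Fintype.card M
      ≤ ρ * Fintype.card M * distTo (Pi.single j 1) (kerCode H) :=
        le_mul_of_one_le_right (by positivity) (mod_cast hdist)
    _ ≤ Fintype.card ι * hammingNorm (H *ᵥ Pi.single j 1) := (isLTC_iff.mp h).2 _
    _ = Fintype.card ι * colWeight H j := by rw [hammingNorm_mulVec_single_one]

theorem IsLTC.soundness_le_sq [Nonempty ι] (h : IsLTC H ρ w) (hρ : 0 ≤ ρ) (hw : IsLDPC H w)
    (hH : ∀ j, 0 < colWeight H j) : ρ ≤ w ^ 2 := by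
  obtain ⟨j⟩ := ‹Nonempty ι›
  obtain ⟨i, -⟩ : ∃ i, H i j ≠ 0 := Function.ne_iff.mp (hammingNorm_pos_iff.mp (hH j))
  have hM : (0 : ℝ) < Fintype.card M := Nat.cast_pos.mpr (Fintype.card_pos_iff.mpr ⟨i⟩)
  have hι : (Fintype.card ι : ℝ) ≤ w * Fintype.card M :=
    mod_cast card_le_mul_card_of_colWeight_pos hw.1 hH
  refine le_of_mul_le_mul_right ?_ hM
  calc ρ * Fintype.card M ≤ Fintype.card ι * colWeight H j := h.soundness_mul_card_le hρ (hH j)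
    _ ≤ (w * Fintype.card M) * w := by gcongr; exact hw.2 j
    _ = w ^ 2 * Fintype.card M := by ring

theorem IsLTC.soundness_mul_le_mul_min [Nonempty ι] (h : IsLTC H ρ w) (hρ : 0 ≤ ρ)
    (hw : IsLDPC H w) (hH : ∀ j, 0 < colWeight H j) :
    ρ * (Fintype.card M + 3 * Fintype.card ι) ≤
      4 * (w + 1) ^ 3 * (min ρ 1 * Fintype.card M) := by
  have hw₀ : (0 : ℝ) ≤ w := Nat.cast_nonneg w
  have : 0 ≤ min ρ 1 := le_min hρ zero_le_one
  have hmin : ρ ≤ (w + 1) ^ 2 * min ρ 1 := by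
    rcases min_choice ρ 1 with h' | h' <;> rw [h']
    · exact le_mul_of_one_le_left hρ (one_le_pow₀ (le_add_of_nonneg_left hw₀))
    · linarith [h.soundness_le_sq hρ hw hH, hw₀]
  have hι : (Fintype.card ι : ℝ) ≤ w * Fintype.card M :=
    mod_cast card_le_mul_card_of_colWeight_pos hw.1 hH
  calc ρ * (Fintype.card M + 3 * Fintype.card ι)
      ≤ ((w + 1) ^ 2 * min ρ 1) * (4 * (w + 1) * Fintype.card M) := by
        gcongr
        nlinarith [(Nat.cast_nonneg _ : (0 : ℝ) ≤ Fintype.card M)]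
    _ = 4 * (w + 1) ^ 3 * (min ρ 1 * Fintype.card M) := by ring

theorem IsLTC.soundness_mul_le_mul_card [Nonempty ι] (h : IsLTC H ρ w) (hρ : 0 ≤ ρ)
    (hw : IsLDPC H w) (hH : ∀ j, 0 < colWeight H j) :
    ρ * (Fintype.card M + 3 * Fintype.card ι) ≤ 4 * (w + 1) ^ 3 * Fintype.card ι := by
  have hw₀ : (0 : ℝ) ≤ w := Nat.cast_nonneg w
  have hM : ρ * Fintype.card M ≤ w * Fintype.card ι := by
    obtain ⟨j⟩ := ‹Nonempty ι›
    rw [mul_comm (w : ℝ)]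
    exact (h.soundness_mul_card_le hρ (hH j)).trans (by gcongr; exact hw.2 j)
  calc ρ * (Fintype.card M + 3 * Fintype.card ι)
      = ρ * Fintype.card M + 3 * (ρ * Fintype.card ι) := by ring
    _ ≤ w * Fintype.card ι + 3 * (w ^ 2 * Fintype.card ι) := by
        gcongr
        exact h.soundness_le_sq hρ hw hH
    _ = (w + 3 * w ^ 2) * Fintype.card ι := by ring
    _ ≤ 4 * (w + 1) ^ 3 * Fintype.card ι := by
        gcongr
        nlinarith [pow_nonneg hw₀ 3]

end Locality

/-! ### The star-balanced gauge-fixed code -/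

section StarBalancedGaugeFixed

variable {M ι : Type*} [Fintype M] [Fintype ι]

theorem card_checks_starBalance_gaugeFixed_le {p : ℕ} :
    (Fintype.card ((M × Fin (p + 1)) ⊕ (((ι ⊕ ι) × Fin p) ⊕ (ι × Fin (p + 1)))) : ℝ) ≤
      (Fintype.card M + 3 * Fintype.card ι) * (p + 1) := by
  simp only [Fintype.card_sum, Fintype.card_prod, Fintype.card_fin]
  push_cast
  linarith [(Nat.cast_nonneg _ : (0 : ℝ) ≤ Fintype.card ι)]

variable [DecidableEq M] [DecidableEq ι] {H : Matrix M ι (ZMod 2)} {p w : ℕ} {ρ : ℝ}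

theorem hasParams_starBalance_gaugeFixed {n k d : ℕ} (hC : HasParams (kerCode H) n k d) :
    ((gaugeFixed H).starBalance p).HasParams (2 * n * (p + 1) + Fintype.card M * p) k
      (min d (2 * (p + 1))) := by
  obtain ⟨rfl, rfl, hmin⟩ := hC
  have hC₀ : kerCode H ≠ ⊥ := by
    obtain ⟨c, hc, hc0, -⟩ := hmin.1
    exact Submodule.ne_bot_iff _ |>.mpr ⟨c, hc, hc0⟩
  refine ⟨?_, ?_, CSSCode.isLeast_logicalWeights ?_ ?_⟩
  · simp only [Fintype.card_sum, Fintype.card_prod, Fintype.card_fin, two_mul]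
  · rw [CSSCode.finrank_codeSpace, CSSCode.finrank_logicalClasses_starBalance,
      finrank_logicalClasses_gaugeFixed]
  · exact CSSCode.isLeast_nontrivialWeights_starBalance_X
      (isLeast_nontrivialWeights_gaugeFixed_X hmin)
  · rw [mul_comm]
    exact CSSCode.isLeast_nontrivialWeights_starBalance_Z
      (isLeast_nontrivialWeights_gaugeFixed_Z hC₀)

theorem isLTC_starBalance_gaugeFixed_hX {K : ℕ} (hp : 0 < p) (hρ : 0 ≤ ρ) (h : IsLTC H ρ w)
    (hK : ∀ i, rowWeight ((gaugeFixed H).starBalance p).hX i ≤ K) :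
    IsLTC ((gaugeFixed H).starBalance p).hX (1 / 3 * min ρ 1) K := by
  refine ((gaugeFixed H).isLTC_starBalance_hX hp (by positivity) (isLTC_gaugeFixed_hX hρ h)
    hK).mono ?_ le_rfl
  have hmin : min ρ 1 ≤ min (2 * ρ) 1 := min_le_min_right 1 (by linarith)
  have hmin₀ : 0 ≤ min ρ 1 := le_min hρ zero_le_one
  linarith

theorem distTo_kerCode_starBalance_gaugeFixed_hZ_le
    (q : ((ι ⊕ ι) × Fin (p + 1)) ⊕ (M × Fin p) → ZMod 2) :
    distTo q (kerCode ((gaugeFixed H).starBalance p).hZ) ≤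
      2 * hammingNorm (((gaugeFixed H).starBalance p).hZ *ᵥ q) := by
  refine ((gaugeFixed H).distTo_kerCode_starBalance_hZ_le q (b := 1) (κ := 1)
    (fun a => (colWeight_gaugeFixed_hZ a).le) fun x => ?_).trans ?_
  · simpa using distTo_kerCode_gaugeFixed_hZ_le x
  · rw [hammingNorm_sum_type (((gaugeFixed H).starBalance p).hZ *ᵥ q)]
    linarith

theorem isLTC_starBalance_gaugeFixed_hZ {K : ℕ}
    (hK : ∀ i, rowWeight ((gaugeFixed H).starBalance p).hZ i ≤ K) :
    IsLTC ((gaugeFixed H).starBalance p).hZ (1 / 3) K := by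
  refine isLTC_of_distTo_le (κ := 2) hK (by norm_num) ?_ fun q => ?_
  · simp only [Fintype.card_sum, Fintype.card_prod, Fintype.card_fin]
    push_cast
    have hM : (0 : ℝ) ≤ Fintype.card M * p := by positivity
    linarith [(Nat.cast_nonneg _ : (0 : ℝ) ≤ Fintype.card ι)]
  · exact mod_cast distTo_kerCode_starBalance_gaugeFixed_hZ_le q

theorem isQLTC_starBalance_gaugeFixed [Nonempty ι] {K : ℕ} (hp : 0 < p) (hρ : 0 ≤ ρ)
    (hw : IsLDPC H w) (hH : ∀ j, 0 < colWeight H j) (h : IsLTC H ρ w)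
    (hKX : ∀ i, rowWeight ((gaugeFixed H).starBalance p).hX i ≤ K)
    (hKZ : ∀ i, rowWeight ((gaugeFixed H).starBalance p).hZ i ≤ K) :
    ((gaugeFixed H).starBalance p).IsQLTC (1 / (12 * (w + 1) ^ 3) * ρ) K := by
  have hcard := card_checks_starBalance_gaugeFixed_le (M := M) (ι := ι) (p := p)
  have hscale {B : ℝ} (hB : ρ * (Fintype.card M + 3 * Fintype.card ι) ≤ 4 * (w + 1) ^ 3 * B) :
      1 / (12 * (w + 1) ^ 3) * ρ *
        Fintype.card ((M × Fin (p + 1)) ⊕ (((ι ⊕ ι) × Fin p) ⊕ (ι × Fin (p + 1)))) ≤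
          1 / 3 * B * (p + 1) := calc
    _ ≤ 1 / (12 * (w + 1) ^ 3) * ρ * ((Fintype.card M + 3 * Fintype.card ι) * (p + 1)) := by
        gcongr
    _ = 1 / (12 * (w + 1) ^ 3) * (ρ * (Fintype.card M + 3 * Fintype.card ι)) * (p + 1) := by ring
    _ ≤ 1 / (12 * (w + 1) ^ 3) * (4 * (w + 1) ^ 3 * B) * (p + 1) := by gcongr
    _ = 1 / 3 * B * (p + 1) := by field_simp; ring
  refine CSSCode.isQLTC_of_isLTC (by positivity) (isLTC_starBalance_gaugeFixed_hX hp hρ h hKX)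
    (isLTC_starBalance_gaugeFixed_hZ hKZ) ?_ ?_
  · refine (hscale (h.soundness_mul_le_mul_min hρ hw hH)).trans_eq ?_
    simp only [Fintype.card_prod, Fintype.card_fin]
    push_cast
    ring
  · refine (hscale (h.soundness_mul_le_mul_card hρ hw hH)).trans ?_
    simp only [Fintype.card_sum, Fintype.card_prod, Fintype.card_fin]
    push_cast
    linarith [show (0 : ℝ) ≤ Fintype.card ι * p by positivity]

end StarBalancedGaugeFixed

theorem mainTheorem2 :
    ∃ c₀ : ℝ, 0 < c₀ ∧ ∀ w : ℕ, ∃ (c : ℝ) (K : ℕ), 0 < c ∧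
      ∀ (ℓ n m k d : ℕ) (ρ : ℝ) (H : Matrix (Fin m) (Fin n) (ZMod 2)),
        2 ≤ ℓ → 0 < ρ → IsLDPC H w → HasParams (kerCode H) n k d → IsLTC H ρ w →
        -- parameters
        (starBalanced H ℓ).HasParams (2 * n * ℓ + m * (ℓ - 1)) k (min d (2 * ℓ)) ∧
        -- quantum soundness, and soundness of the two classical component codes
        (2 ≤ d → (starBalanced H ℓ).IsQLTC (c * ρ) (K * ℓ)) ∧
        IsLTC (starBalanced H ℓ).hX (c₀ * min ρ 1) (K * ℓ) ∧
        IsLTC (starBalanced H ℓ).hZ c₀ (K * ℓ) ∧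
        -- weights of the X-generators
        (∃ S : Finset (Fin m × Fin ℓ), ℓ * S.card = Fintype.card (Fin m × Fin ℓ) ∧
          (∀ i ∈ S, ℓ ≤ K * rowWeight (starBalanced H ℓ).hX i ∧
            rowWeight (starBalanced H ℓ).hX i ≤ K * ℓ) ∧
          ∀ i ∉ S, rowWeight (starBalanced H ℓ).hX i ≤ K) ∧
        -- weights of the Z-generators
        (∀ i, rowWeight (starBalanced H ℓ).hZ i ≤ K) ∧
        -- number of Z-generators at each qubit
        (∃ T : Finset (((Fin n ⊕ Fin n) × Fin ℓ) ⊕ (Fin m × Fin (ℓ - 1))),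
          ℓ * T.card ≤ Fintype.card (((Fin n ⊕ Fin n) × Fin ℓ) ⊕ (Fin m × Fin (ℓ - 1))) ∧
          (∀ q ∈ T, ℓ ≤ K * colWeight (starBalanced H ℓ).hZ q ∧
            colWeight (starBalanced H ℓ).hZ q ≤ K * ℓ) ∧
          ∀ q ∉ T, colWeight (starBalanced H ℓ).hZ q ≤ K) ∧
        -- number of X-generators at each qubit
        (∀ q, colWeight (starBalanced H ℓ).hX q ≤ K) := by
  refine ⟨1 / 3, by norm_num, fun w => ⟨1 / (12 * (w + 1) ^ 3), 2 * w + 3, by positivity, ?_⟩⟩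
  intro ℓ n m k d ρ H hℓ hρ hw hC hH
  obtain ⟨p, rfl⟩ : ∃ p, ℓ = p + 1 := ⟨ℓ - 1, by omega⟩
  have hp : 0 < p := by omega
  have hrow (i : Fin m) : rowWeight (gaugeFixed H).hX i + 2 ≤ 2 * w + 3 := by
    linarith [rowWeight_gaugeFixed_hX (H := H) i, hw.1 i]
  have hcol (a : Fin n ⊕ Fin n) : 2 + colWeight (gaugeFixed H).hX a ≤ 2 * w + 3 := by
    linarith [colWeight_gaugeFixed_hX (H := H) a, hw.2 (a.elim id id)]
  have hX := CSSCode.rowWeight_starBalance_hX_le (p := p) fun i => (Nat.le_succ _).trans (hrow i)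
  have hZ := CSSCode.rowWeight_starBalance_hZ_le (p := p) hcol fun j =>
    (rowWeight_gaugeFixed_hZ j).trans_le (by omega)
  have hZ' := fun s => (hZ s).trans (Nat.le_mul_of_pos_right _ p.succ_pos)
  have hparams := hasParams_starBalance_gaugeFixed (p := p) hC
  rw [Fintype.card_fin] at hparams
  refine ⟨hparams, fun hd => ?_,
    isLTC_starBalance_gaugeFixed_hX hp hρ.le hH hX, isLTC_starBalance_gaugeFixed_hZ hZ',
    CSSCode.exists_heavy_rows_starBalance_hX hp hrow, hZ,
    CSSCode.exists_heavy_cols_starBalance_hZ (fun i => by linarith [hrow i])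
      (fun a => by rw [colWeight_gaugeFixed_hZ]; omega)
      (fun a => by rw [colWeight_gaugeFixed_hZ]; exact one_pos),
    CSSCode.colWeight_starBalance_hX_le (by omega) fun a => by linarith [hcol a]⟩
  have hcol₀ := colWeight_pos_of_two_le_hammingNorm fun c hc hc0 =>
    hd.trans (hC.2.2.2 ⟨c, hc, hc0, rfl⟩)
  obtain ⟨c, -, hc, -⟩ := hC.2.2.1
  have : Nonempty (Fin n) := (Function.ne_iff.mp hc).nonempty
  exact isQLTC_starBalance_gaugeFixed hp hρ.le hw hcol₀ hH hX hZ'
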